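/- Let $p$ be a prime number, let $K/\mathbf{Q}_p$ be a field extension (not necessarily complete) equipped with an ultrametric absolute value extending that of $\mathbf{Q}_p$, and let $C$ be an algebraically closed field extension of $K$ equipped with an ultrametric absolute value extending that of $K$. Consider the differential equation $y'=L(T)\,y$ with $0\neq L\in K[T]$, and let $P(T)=\sum_{i=1}^{D}a_iT^i\in K[T]$ be the primitive of $L$ with $P(0)=0$, where $D\geq 1$ is the degree of $P$; thus $\exp(P(T))\in K[[T]]$ is a formal solution of the equation. For $1\leq n\leq D$ let $d_n=\lfloor\log_p(D/n)\rfloor$ and put $d=d_1$. Let $\zeta\in C$ be a root of unity of order exactly $p^{d+1}$, and put $\zeta_{d-i}=\zeta^{p^i}$ for $0\leq i\leq d$. Define $$\widetilde P(T)=\sum_{n=1}^{D}\frac{a_n}{\zeta_{d_n}-1}\,T^n\in C[T],$$ and let $\tilde e(T)=1+\sum_{i=1}^{D}\tilde a_iT^i$ be the polynomial obtained from the formal power series $\exp(\widetilde P(T))$ by keeping only the terms of degree at most $D$. Then the radius of convergence $\rho$ of the power series $\exp(P(T))$ is finite, and $$\rho=\max\Bigl\{|\lambda| \;:\; \lambda\in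 C,\ \max_{1\leq i\leq D}|\tilde a_i|\,|\lambda|^i\leq 1\Bigr\},$$ where in particular the maximum is attained. -/

import Mathlib

open scoped Polynomial PowerSeries

noncomputable section

namespace ExpRadius

/-- The formal power series `exp(Q(T))`, for a polynomial `Q` without constant term. -/
def formalExp {F : Type*} [Field F] [CharZero F] (Q : F[X]) : F⟦X⟧ :=
  (PowerSeries.exp F).subst (Q : F⟦X⟧)

/-- The integer `d_n = ⌊log_p (D / n)⌋` for `1 ≤ n ≤ D`, that is, the largest `d` such that
`n * p ^ d ≤ D`. -/
def levelIndex (p D n : ℕ) : ℕ := Nat.log p (D / n)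

/-- Given `ζ` of order `p ^ (d + 1)`, where `d = d_1`, the root of unity `ζ_{d_n}` of order
`p ^ (d_n + 1)`, where `ζ_d = ζ` and `ζ_{d - i} = ζ ^ (p ^ i)`. -/
def levelRoot {F : Type*} [Field F] (p D : ℕ) (ζ : F) (n : ℕ) : F :=
  ζ ^ p ^ (levelIndex p D 1 - levelIndex p D n)

/-- For `Q = a_1 T + ... + a_D T ^ D`, the polynomial
`∑ a_n / (ζ_{d_n} - 1) T ^ n`, the sum running over `1 ≤ n ≤ D`. -/
def tildePoly {F : Type*} [Field F] (p D : ℕ) (ζ : F) (Q : F[X]) : F[X] :=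
  ∑ n ∈ Finset.Icc 1 D, Polynomial.monomial n (Q.coeff n / (levelRoot p D ζ n - 1))

/-- The truncation of `exp(Q̃(T))` to the terms of degree at most `D`. -/
def tildeExp {F : Type*} [Field F] [CharZero F] (p D : ℕ) (ζ : F) (Q : F[X]) : F[X] :=
  PowerSeries.trunc (D + 1) (formalExp (tildePoly p D ζ Q))

/-- The radius of convergence, in `[0, ∞]`, of the one-variable power series `f`. -/
def radiusOfConvergence {K : Type*} [NontriviallyNormedField K] (f : K⟦X⟧) : ENNReal :=
  (FormalMultilinearSeries.ofScalars K fun n => PowerSeries.coeff n f).radius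

end ExpRadius

end

namespace ExpRadius

section Formal

variable {F : Type*} [Field F]

/-! Replacing `T` by `λT` multiplies the `i`-th coefficients of both `exp(P)` and the truncated
`exp(P̃)` by `λ ^ i`. As `C` is algebraically closed, `λ` can be chosen so that the largest `|ã_i|`
becomes `1`; it remains to see that the rescaled exponential `exp(Q)` has radius exactly `1`.

Let `E = exp(∑ T ^ (p ^ k) / p ^ k)`, which has integral coefficients by Dwork's criterion
(`gaussBound_of_pow_eq`). Up to degree `D`, `exp(Q̃)` is a product of factors `E(c_n T ^ n)`, where
`c_n` is `param`. If the `ã_i` are integral, so are the `c_n`; if all `|c_n| < 1`, then all `|ã_i| <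
1`.

Let `z_n` be the root of unity `ζ_{d_n}`. Passing from `E(c_n T ^ n)` to `E(z_n c_n T ^ n)`
multiplies the term of degree `m = n p ^ k` of the logarithm by `z_m` when `m ≤ D`, and by `1`
beyond. The difference of the two logarithms thus cancels the denominators of `Q̃` and has no tail,
so that `exp(Q) = ∏ E(z_n c_n T ^ n) / E(c_n T ^ n)` exactly (`fexp_eq_prod_ahQuot`). Hence `exp(Q)`
is integral and its radius is at least `1`.

For the converse, take `n₀` with `d_n` largest among the `n` with `|c_n| = 1`. Factors with larger
`d_n` have `|c_n| < 1`, so their inverses are bounded on a disc of radius `> 1` and they can be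
divided out. Modulo `(z_n - 1) ^ 2` each remaining factor is `1 + (z_n - 1) ∑ (c_n T ^ n) ^ (p ^
k)`. In every degree `n₀ p ^ k` the factor of `n₀` strictly dominates, because `|z_n - 1|` grows
with the order of `z_n`. Infinitely many coefficients therefore share one nonzero norm, which
excludes a radius `> 1`. -/

lemma derivative_map {G : Type*} [Field G] (φ : F →+* G) (f : F⟦X⟧) :
    PowerSeries.derivative G (PowerSeries.map φ f)
      = PowerSeries.map φ (PowerSeries.derivative F f) := by
  ext n
  simp [PowerSeries.coeff_derivative]

/-! ### Substitution of a monomial -/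

/-- The power series `f(c T ^ n)`. -/
noncomputable def dilate (n : ℕ) (c : F) (f : F⟦X⟧) : F⟦X⟧ :=
  f.subst (PowerSeries.monomial n c)

lemma constantCoeff_monomial_eq_zero {n : ℕ} (hn : n ≠ 0) (c : F) :
    PowerSeries.constantCoeff (PowerSeries.monomial n c) = 0 := by
  rw [← PowerSeries.coeff_zero_eq_constantCoeff_apply, PowerSeries.coeff_monomial,
    if_neg (Ne.symm hn)]

lemma coeff_dilate {n : ℕ} (hn : n ≠ 0) (c : F) (f : F⟦X⟧) (m : ℕ) :
    PowerSeries.coeff m (dilate n c f) =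
      if n ∣ m then PowerSeries.coeff (m / n) f * c ^ (m / n) else 0 := by
  rw [dilate, PowerSeries.coeff_subst' (PowerSeries.HasSubst.monomial' hn c)]
  have hpow : ∀ d, PowerSeries.coeff m (PowerSeries.monomial n c ^ d) =
      if m = d * n then c ^ d else 0 := by
    intro d
    rw [PowerSeries.monomial_pow, PowerSeries.coeff_monomial]
  simp only [hpow]
  split_ifs with h
  · obtain ⟨k, rfl⟩ := h
    rw [Nat.mul_div_cancel_left _ (Nat.pos_of_ne_zero hn)]
    rw [finsum_eq_single _ k]
    · rw [if_pos (mul_comm _ _), smul_eq_mul]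
    · intro d hd
      rw [if_neg, smul_zero]
      intro h
      rw [mul_comm n k] at h
      exact hd (Nat.eq_of_mul_eq_mul_right (Nat.pos_of_ne_zero hn) h).symm
  · rw [finsum_eq_zero_of_forall_eq_zero]
    intro d
    rw [if_neg, smul_zero]
    rintro rfl
    exact h (Dvd.intro_left d rfl)

lemma dilate_mul {n : ℕ} (hn : n ≠ 0) (c : F) (f g : F⟦X⟧) :
    dilate n c (f * g) = dilate n c f * dilate n c g :=
  PowerSeries.subst_mul (PowerSeries.HasSubst.monomial' hn c) f g

lemma constantCoeff_dilate {n : ℕ} (hn : n ≠ 0) (c : F) (f : F⟦X⟧) :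
    PowerSeries.constantCoeff (dilate n c f) = PowerSeries.constantCoeff f := by
  rw [← PowerSeries.coeff_zero_eq_constantCoeff_apply, coeff_dilate hn]
  simp

lemma dilate_neg {n : ℕ} (hn : n ≠ 0) (c : F) (f : F⟦X⟧) :
    dilate n c (-f) = - dilate n c f := by
  ext m
  rw [map_neg, coeff_dilate hn, coeff_dilate hn]
  split_ifs <;> simp

lemma dilate_dilate_one {n : ℕ} (hn : n ≠ 0) (c d : F) (f : F⟦X⟧) :
    dilate n c (dilate 1 d f) = dilate n (d * c) f := by
  ext m
  rw [coeff_dilate hn, coeff_dilate hn]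
  split_ifs
  · rw [coeff_dilate one_ne_zero, if_pos (one_dvd _), Nat.div_one, mul_pow, mul_assoc]
  · rfl

/-! ### The exponential of a power series without constant term -/

variable [CharZero F]

/-- The power series `exp(A(T))`, for a power series `A` without constant term. -/
noncomputable def fexp (A : F⟦X⟧) : F⟦X⟧ := (PowerSeries.exp F).subst A

lemma formalExp_eq_fexp (Q : F[X]) : formalExp Q = fexp (Q : F⟦X⟧) := rfl

lemma constantCoeff_fexp {A : F⟦X⟧} (hA : PowerSeries.constantCoeff A = 0) :
    PowerSeries.constantCoeff (fexp A) = 1 := by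
  have h := PowerSeries.HasSubst.of_constantCoeff_zero' hA
  have h1 : fexp A - 1 = (PowerSeries.exp F - 1).subst A := by
    rw [PowerSeries.subst_sub h, fexp]
    congr 1
    rw [← PowerSeries.coe_substAlgHom h, map_one]
  have h2 : PowerSeries.constantCoeff (fexp A - 1) = 0 := by
    rw [h1]
    exact PowerSeries.constantCoeff_subst_eq_zero hA _ (by simp)
  rw [map_sub, map_one, sub_eq_zero] at h2
  exact h2

lemma derivative_fexp {A : F⟦X⟧} (hA : PowerSeries.constantCoeff A = 0) :
    PowerSeries.derivative F (fexp A) = PowerSeries.derivative F A * fexp A := by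
  have h := PowerSeries.HasSubst.of_constantCoeff_zero' hA
  rw [fexp, PowerSeries.derivative_subst h, PowerSeries.derivative_exp, mul_comm]

lemma eq_one_of_derivative_eq_zero {f : F⟦X⟧} (h : PowerSeries.derivative F f = 0)
    (h0 : PowerSeries.constantCoeff f = 1) : f = 1 :=
  PowerSeries.derivative.ext (by rw [h, PowerSeries.derivative_one]) (by rw [h0, map_one])

lemma fexp_mul_fexp_neg {A : F⟦X⟧} (hA : PowerSeries.constantCoeff A = 0) :
    fexp A * fexp (-A) = 1 := by
  have hA' : PowerSeries.constantCoeff (-A) = 0 := by rw [map_neg, hA, neg_zero]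
  refine eq_one_of_derivative_eq_zero ?_ ?_
  · rw [Derivation.leibniz, derivative_fexp hA, derivative_fexp hA', smul_eq_mul, smul_eq_mul,
      map_neg]
    ring
  · rw [map_mul, constantCoeff_fexp hA, constantCoeff_fexp hA', one_mul]

/-- The product `f * fexp (-A)` has zero derivative, hence is constant in characteristic zero.
Additivity of `fexp` and its compatibility with field morphisms reduce to this uniqueness for `y' =
A' y`. -/
lemma fexp_unique {A f : F⟦X⟧} (hA : PowerSeries.constantCoeff A = 0)
    (hf : PowerSeries.derivative F f = PowerSeries.derivative F A * f)
    (h0 : PowerSeries.constantCoeff f = 1) : f = fexp A := by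
  have hA' : PowerSeries.constantCoeff (-A) = 0 := by rw [map_neg, hA, neg_zero]
  have h1 : f * fexp (-A) = 1 := by
    refine eq_one_of_derivative_eq_zero ?_ ?_
    · rw [Derivation.leibniz, hf, derivative_fexp hA', smul_eq_mul, smul_eq_mul, map_neg]
      ring
    · rw [map_mul, h0, constantCoeff_fexp hA', one_mul]
  calc f = f * (fexp A * fexp (-A)) := by rw [fexp_mul_fexp_neg hA, mul_one]
    _ = (f * fexp (-A)) * fexp A := by ring
    _ = fexp A := by rw [h1, one_mul]

lemma fexp_add {A B : F⟦X⟧} (hA : PowerSeries.constantCoeff A = 0)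
    (hB : PowerSeries.constantCoeff B = 0) : fexp (A + B) = fexp A * fexp B := by
  symm
  refine fexp_unique (by rw [map_add, hA, hB, add_zero]) ?_ ?_
  · rw [Derivation.leibniz, derivative_fexp hA, derivative_fexp hB, smul_eq_mul, smul_eq_mul,
      map_add]
    ring
  · rw [map_mul, constantCoeff_fexp hA, constantCoeff_fexp hB, one_mul]

lemma fexp_zero : fexp (0 : F⟦X⟧) = 1 := (fexp_unique (by simp) (by simp) (by simp)).symm

lemma fexp_sub {A B : F⟦X⟧} (hA : PowerSeries.constantCoeff A = 0)
    (hB : PowerSeries.constantCoeff B = 0) : fexp (A - B) = fexp A * fexp (-B) := by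
  rw [sub_eq_add_neg, fexp_add hA (by rw [map_neg, hB, neg_zero])]

lemma fexp_sum {ι : Type*} (s : Finset ι) (A : ι → F⟦X⟧)
    (hA : ∀ i ∈ s, PowerSeries.constantCoeff (A i) = 0) :
    fexp (∑ i ∈ s, A i) = ∏ i ∈ s, fexp (A i) := by
  classical
  induction s using Finset.induction_on with
  | empty => simp [fexp_zero]
  | insert a s ha ih =>
    have hs : ∀ i ∈ s, PowerSeries.constantCoeff (A i) = 0 :=
      fun i hi => hA i (Finset.mem_insert_of_mem hi)
    rw [Finset.sum_insert ha, Finset.prod_insert ha, ← ih hs,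
      fexp_add (hA a (Finset.mem_insert_self _ _))]
    rw [map_sum]
    exact Finset.sum_eq_zero hs

lemma fexp_nsmul {A : F⟦X⟧} (hA : PowerSeries.constantCoeff A = 0) (n : ℕ) :
    fexp (n • A) = fexp A ^ n := by
  have h := fexp_sum (Finset.range n) (fun _ => A) (fun _ _ => hA)
  simpa using h

lemma fexp_subst {A B : F⟦X⟧} (hA : PowerSeries.constantCoeff A = 0)
    (hB : PowerSeries.constantCoeff B = 0) : fexp (A.subst B) = (fexp A).subst B :=
  (PowerSeries.subst_comp_subst_apply (PowerSeries.HasSubst.of_constantCoeff_zero' hA)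
    (PowerSeries.HasSubst.of_constantCoeff_zero' hB) _).symm

lemma map_fexp {G : Type*} [Field G] [CharZero G] (φ : F →+* G) {A : F⟦X⟧}
    (hA : PowerSeries.constantCoeff A = 0) :
    PowerSeries.map φ (fexp A) = fexp (PowerSeries.map φ A) := by
  refine fexp_unique ?_ ?_ ?_
  · rw [← PowerSeries.coeff_zero_eq_constantCoeff_apply, PowerSeries.coeff_map,
      PowerSeries.coeff_zero_eq_constantCoeff_apply, hA, map_zero]
  · rw [derivative_map, derivative_map, derivative_fexp hA, map_mul]
  · rw [← PowerSeries.coeff_zero_eq_constantCoeff_apply, PowerSeries.coeff_map,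
      PowerSeries.coeff_zero_eq_constantCoeff_apply, constantCoeff_fexp hA, map_one]

lemma succ_mul_coeff_fexp {A : F⟦X⟧} (hA : PowerSeries.constantCoeff A = 0) (n : ℕ) :
    ((n : F) + 1) * PowerSeries.coeff (n + 1) (fexp A) =
      ∑ x ∈ Finset.HasAntidiagonal.antidiagonal n,
        ((x.1 : F) + 1) * PowerSeries.coeff (x.1 + 1) A * PowerSeries.coeff x.2 (fexp A) := by
  have h := congrArg (PowerSeries.coeff n) (derivative_fexp hA)
  rw [PowerSeries.coeff_derivative, PowerSeries.coeff_mul] at h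
  rw [mul_comm, h]
  refine Finset.sum_congr rfl fun x _ => ?_
  rw [PowerSeries.coeff_derivative]
  ring

/-- The coefficients of `exp(A)` up to degree `N` depend only on those of `A`. -/
lemma coeff_fexp_congr {A B : F⟦X⟧} (hA : PowerSeries.constantCoeff A = 0)
    (hB : PowerSeries.constantCoeff B = 0) {N : ℕ}
    (h : ∀ i ≤ N, PowerSeries.coeff i A = PowerSeries.coeff i B) :
    ∀ i ≤ N, PowerSeries.coeff i (fexp A) = PowerSeries.coeff i (fexp B) := by
  intro i
  induction i using Nat.strong_induction_on with
  | _ i ih =>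
    intro hi
    cases i with
    | zero =>
      rw [PowerSeries.coeff_zero_eq_constantCoeff_apply,
        PowerSeries.coeff_zero_eq_constantCoeff_apply, constantCoeff_fexp hA,
        constantCoeff_fexp hB]
    | succ n =>
      have hn : ((n : F) + 1) ≠ 0 := by exact_mod_cast Nat.succ_ne_zero n
      refine mul_left_cancel₀ hn ?_
      rw [succ_mul_coeff_fexp hA, succ_mul_coeff_fexp hB]
      refine Finset.sum_congr rfl fun x hx => ?_
      have hx' := Finset.HasAntidiagonal.mem_antidiagonal.1 hx
      rw [h (x.1 + 1) (by omega), ih x.2 (by omega) (by omega)]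

lemma fexp_dilate {n : ℕ} (hn : n ≠ 0) (c : F) {A : F⟦X⟧}
    (hA : PowerSeries.constantCoeff A = 0) : fexp (dilate n c A) = dilate n c (fexp A) :=
  fexp_subst hA (constantCoeff_monomial_eq_zero hn c)

end Formal

/-! ### The Artin-Hasse exponential -/

section ArtinHasse

variable (p : ℕ) (F : Type*) [Field F]

open Classical in
/-- The logarithm `∑ T ^ (p ^ k) / p ^ k` of the Artin-Hasse exponential. -/
noncomputable def ahLog : F⟦X⟧ :=
  PowerSeries.mk fun m => if ∃ k, m = p ^ k then (m : F)⁻¹ else 0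

open Classical in
/-- The power series `∑ T ^ (p ^ k)`. -/
noncomputable def primePowSeries : F⟦X⟧ :=
  PowerSeries.mk fun m => if ∃ k, m = p ^ k then 1 else 0

/-- The Artin-Hasse exponential. -/
noncomputable def artinHasse [CharZero F] : F⟦X⟧ := fexp (ahLog p F)

/-- The inverse of the Artin-Hasse exponential. -/
noncomputable def artinHasseInv [CharZero F] : F⟦X⟧ := fexp (-ahLog p F)

lemma coeff_one_ahLog : PowerSeries.coeff 1 (ahLog p F) = 1 := by
  rw [ahLog, PowerSeries.coeff_mk, if_pos ⟨0, (pow_zero p).symm⟩, Nat.cast_one, inv_one]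

variable [hp : Fact p.Prime]

lemma constantCoeff_ahLog : PowerSeries.constantCoeff (ahLog p F) = 0 := by
  rw [← PowerSeries.coeff_zero_eq_constantCoeff_apply, ahLog, PowerSeries.coeff_mk, if_neg]
  rintro ⟨k, hk⟩
  exact pow_ne_zero k hp.out.ne_zero hk.symm

lemma constantCoeff_neg_ahLog : PowerSeries.constantCoeff (-ahLog p F) = 0 := by
  rw [map_neg, constantCoeff_ahLog, neg_zero]

variable [CharZero F]

lemma constantCoeff_artinHasse : PowerSeries.constantCoeff (artinHasse p F) = 1 :=
  constantCoeff_fexp (constantCoeff_ahLog p F)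

lemma artinHasse_mul_inv : artinHasse p F * artinHasseInv p F = 1 :=
  fexp_mul_fexp_neg (constantCoeff_ahLog p F)

/-- The operator `T d/dT` removes the denominators of `∑ T ^ (p ^ k) / p ^ k`. This produces the
first-order term of `E(zT) / E(T)` at `z = 1`. -/
lemma X_mul_derivative_artinHasse :
    PowerSeries.X * PowerSeries.derivative F (artinHasse p F)
      = primePowSeries p F * artinHasse p F := by
  have h : PowerSeries.X * PowerSeries.derivative F (ahLog p F) = primePowSeries p F := by
    ext m
    cases m with
    | zero =>
      rw [PowerSeries.coeff_zero_X_mul, primePowSeries, PowerSeries.coeff_mk, if_neg]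
      rintro ⟨k, hk⟩
      exact pow_ne_zero k hp.out.ne_zero hk.symm
    | succ m =>
      have hm : ((m : F) + 1) ≠ 0 := by exact_mod_cast Nat.succ_ne_zero m
      rw [PowerSeries.coeff_succ_X_mul, PowerSeries.coeff_derivative, ahLog, primePowSeries,
        PowerSeries.coeff_mk, PowerSeries.coeff_mk]
      split_ifs
      · push_cast
        exact inv_mul_cancel₀ hm
      · rw [zero_mul]
  rw [artinHasse, derivative_fexp (constantCoeff_ahLog p F), ← mul_assoc, h]

lemma coeff_one_artinHasse : PowerSeries.coeff 1 (artinHasse p F) = 1 := by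
  have h := succ_mul_coeff_fexp (constantCoeff_ahLog p F) 0
  simpa [artinHasse, coeff_one_ahLog, constantCoeff_fexp (constantCoeff_ahLog p F)] using h

lemma map_artinHasse {G : Type*} [Field G] [CharZero G] (φ : F →+* G) :
    PowerSeries.map φ (artinHasse p F) = artinHasse p G := by
  rw [artinHasse, map_fexp φ (constantCoeff_ahLog p F), artinHasse]
  congr 1
  ext m
  rw [PowerSeries.coeff_map, ahLog, ahLog, PowerSeries.coeff_mk, PowerSeries.coeff_mk]
  split_ifs <;> simp

/-- On logarithms this is `p ∑ T ^ (p ^ k) / p ^ k = p T + ∑ T ^ (p ^ (k + 1)) / p ^ k`. It is the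
functional equation to which Dwork's criterion applies. -/
lemma artinHasse_pow :
    artinHasse p F ^ p
      = fexp ((p : ℕ) • PowerSeries.X) * dilate p 1 (artinHasse p F) := by
  have hX : PowerSeries.constantCoeff ((p : ℕ) • PowerSeries.X : F⟦X⟧) = 0 := by simp
  have hA := constantCoeff_ahLog p F
  have hp0 := hp.out.ne_zero
  rw [artinHasse, ← fexp_dilate hp0 1 hA, ← fexp_add hX (by rw [constantCoeff_dilate hp0, hA]),
    ← fexp_nsmul hA]
  congr 1
  have hpF : (p : F) ≠ 0 := Nat.cast_ne_zero.2 hp0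
  ext m
  rw [map_add, coeff_dilate hp0, map_nsmul, map_nsmul, PowerSeries.coeff_X, one_pow, mul_one,
    nsmul_eq_mul, nsmul_eq_mul, ahLog, PowerSeries.coeff_mk, PowerSeries.coeff_mk]
  by_cases hm1 : m = 1
  · subst hm1
    rw [if_pos ⟨0, (pow_zero p).symm⟩, if_pos rfl,
      if_neg (fun h => hp.out.one_lt.ne' (Nat.dvd_one.1 h))]
    simp
  by_cases hm : p ∣ m
  · obtain ⟨k, rfl⟩ := hm
    rw [if_neg hm1, if_pos (Dvd.intro _ rfl), Nat.mul_div_cancel_left _ hp.out.pos]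
    have hiff : (∃ j, p * k = p ^ j) ↔ ∃ j, k = p ^ j := by
      constructor
      · rintro ⟨j, hj⟩
        cases j with
        | zero => exact absurd (by simpa using hj) hm1
        | succ j =>
          rw [pow_succ'] at hj
          exact ⟨j, Nat.eq_of_mul_eq_mul_left hp.out.pos hj⟩
      · rintro ⟨j, rfl⟩
        exact ⟨j + 1, (pow_succ' p j).symm⟩
    by_cases hk : ∃ j, k = p ^ j
    · rw [if_pos hk, if_pos (hiff.2 hk)]
      push_cast
      rw [mul_inv, mul_inv_cancel_left₀ hpF]
      ring
    · rw [if_neg hk, if_neg (mt hiff.1 hk)]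
      ring
  · rw [if_neg hm1, if_neg hm, if_neg]
    · ring
    · rintro ⟨j, rfl⟩
      cases j with
      | zero => exact hm1 (pow_zero p)
      | succ j => exact hm (Dvd.intro_left _ (pow_succ p j).symm)

end ArtinHasse

/-! ### Growth of the coefficients of a power series -/

section Growth

variable {C : Type*} [NormedField C]

/-- All the coefficients `f_n` of `f` satisfy `‖f_n‖ s ^ n ≤ M`. -/
def GaussBound (s M : ℝ) (f : C⟦X⟧) : Prop := ∀ n, ‖PowerSeries.coeff n f‖ * s ^ n ≤ M

lemma gaussBound_one_iff {M : ℝ} {f : C⟦X⟧} :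
    GaussBound 1 M f ↔ ∀ n, ‖PowerSeries.coeff n f‖ ≤ M := by
  simp [GaussBound]

lemma GaussBound.nonneg {s M : ℝ} {f : C⟦X⟧} (h : GaussBound s M f) : 0 ≤ M := by
  have h0 := h 0
  rw [pow_zero, mul_one] at h0
  exact (norm_nonneg _).trans h0

lemma GaussBound.anti {s t M : ℝ} {f : C⟦X⟧} (h : GaussBound t M f) (hs : 0 ≤ s) (hst : s ≤ t) :
    GaussBound s M f := fun n =>
  (mul_le_mul_of_nonneg_left (pow_le_pow_left₀ hs hst n) (norm_nonneg _)).trans (h n)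

lemma gaussBound_one {s : ℝ} : GaussBound s 1 (1 : C⟦X⟧) := by
  intro n
  rw [PowerSeries.coeff_one]
  split_ifs with h
  · subst h
    simp
  · simp

lemma gaussBound_dilate {s M : ℝ} {n : ℕ} (hn : n ≠ 0) {c : C} (hc : ‖c‖ * s ^ n ≤ 1) (hs : 0 ≤ s)
    {f : C⟦X⟧} (hf : GaussBound 1 M f) : GaussBound s M (dilate n c f) := by
  intro m
  rw [coeff_dilate hn]
  split_ifs with h
  · obtain ⟨k, rfl⟩ := h
    rw [Nat.mul_div_cancel_left _ (Nat.pos_of_ne_zero hn), norm_mul, norm_pow, pow_mul, mul_assoc,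
      ← mul_pow]
    have h1 : (‖c‖ * s ^ n) ^ k ≤ 1 :=
      pow_le_one₀ (mul_nonneg (norm_nonneg _) (pow_nonneg hs _)) hc
    exact (mul_le_of_le_one_right (norm_nonneg _) h1).trans (gaussBound_one_iff.1 hf k)
  · rw [norm_zero, zero_mul]
    exact hf.nonneg

variable [IsUltrametricDist C]

lemma GaussBound.mul {s M N : ℝ} {f g : C⟦X⟧} (hs : 0 ≤ s) (hf : GaussBound s M f)
    (hg : GaussBound s N g) : GaussBound s (M * N) (f * g) := by
  intro n
  have hpow : ‖PowerSeries.coeff n (f * g)‖ * s ^ n ≤ M * N := by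
    rw [PowerSeries.coeff_mul]
    obtain ⟨x, hx, hle⟩ := IsUltrametricDist.exists_norm_finsetSum_le_of_nonempty
      (t := Finset.HasAntidiagonal.antidiagonal n) ⟨(0, n), by simp⟩
      (fun x => PowerSeries.coeff x.1 f * PowerSeries.coeff x.2 g)
    refine (mul_le_mul_of_nonneg_right hle (pow_nonneg hs n)).trans ?_
    rw [← Finset.HasAntidiagonal.mem_antidiagonal.1 hx, pow_add, norm_mul, mul_mul_mul_comm]
    exact mul_le_mul (hf _) (hg _) (mul_nonneg (norm_nonneg _) (pow_nonneg hs _)) hf.nonneg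
  exact hpow

lemma GaussBound.prod {ι : Type*} {s : ℝ} (hs : 0 ≤ s) (S : Finset ι) {f : ι → C⟦X⟧}
    (hf : ∀ i ∈ S, GaussBound s 1 (f i)) : GaussBound s 1 (∏ i ∈ S, f i) := by
  classical
  induction S using Finset.induction_on with
  | empty => exact gaussBound_one
  | insert a S ha ih =>
    rw [Finset.prod_insert ha, ← mul_one (1 : ℝ)]
    exact (hf a (Finset.mem_insert_self _ _)).mul hs
      (ih fun i hi => hf i (Finset.mem_insert_of_mem hi))

lemma norm_add_le_of_le {x y : C} {M : ℝ} (hx : ‖x‖ ≤ M) (hy : ‖y‖ ≤ M) : ‖x + y‖ ≤ M :=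
  (IsUltrametricDist.norm_add_le_max x y).trans (max_le hx hy)

lemma norm_sub_le_of_le {x y : C} {M : ℝ} (hx : ‖x‖ ≤ M) (hy : ‖y‖ ≤ M) : ‖x - y‖ ≤ M := by
  rw [sub_eq_add_neg]
  exact norm_add_le_of_le hx (by rwa [norm_neg])

lemma norm_add_lt_of_lt {x y : C} {M : ℝ} (hx : ‖x‖ < M) (hy : ‖y‖ < M) : ‖x + y‖ < M :=
  (IsUltrametricDist.norm_add_le_max x y).trans_lt (max_lt hx hy)

lemma norm_add_eq_of_lt {x y : C} (h : ‖y‖ < ‖x‖) : ‖x + y‖ = ‖x‖ := by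
  rw [IsUltrametricDist.norm_add_eq_max_of_norm_ne_norm h.ne', max_eq_left h.le]

lemma norm_sum_lt_of_lt {ι : Type*} {S : Finset ι} {f : ι → C} {M : ℝ} (hM : 0 < M)
    (hf : ∀ i ∈ S, ‖f i‖ < M) : ‖∑ i ∈ S, f i‖ < M := by
  rcases S.eq_empty_or_nonempty with rfl | hS
  · simpa using hM
  · obtain ⟨i, hi, hle⟩ := IsUltrametricDist.exists_norm_finsetSum_le_of_nonempty hS f
    exact hle.trans_lt (hf i hi)

/-- Since `f` has constant term `1`, each coefficient of `g` is an integral combination of the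
previous ones. -/
lemma gaussBound_one_of_mul_eq_one {f g : C⟦X⟧} (hfg : f * g = 1)
    (h0 : PowerSeries.constantCoeff f = 1) (hf : GaussBound 1 1 f) : GaussBound 1 1 g := by
  rw [gaussBound_one_iff] at hf ⊢
  intro n
  induction n using Nat.strong_induction_on with
  | _ n ih =>
    have h := congrArg (PowerSeries.coeff n) hfg
    rw [PowerSeries.coeff_mul] at h
    cases n with
    | zero =>
      rw [Finset.Nat.antidiagonal_zero, Finset.sum_singleton,
        PowerSeries.coeff_zero_eq_constantCoeff_apply,
        PowerSeries.coeff_zero_eq_constantCoeff_apply, h0, one_mul, PowerSeries.coeff_zero_one] at h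
      rw [PowerSeries.coeff_zero_eq_constantCoeff_apply, h, norm_one]
    | succ n =>
      rw [Finset.Nat.antidiagonal_succ, Finset.sum_cons,
        PowerSeries.coeff_zero_eq_constantCoeff_apply,
        h0, one_mul, Finset.sum_map, PowerSeries.coeff_one, if_neg (Nat.succ_ne_zero n)] at h
      rw [eq_neg_of_add_eq_zero_left h, norm_neg]
      refine IsUltrametricDist.norm_sum_le_of_forall_le_of_nonneg zero_le_one fun x hx => ?_
      have hx' := Finset.HasAntidiagonal.mem_antidiagonal.1 hx
      rw [norm_mul]
      exact mul_le_one₀ (hf _) (norm_nonneg _) (ih _ (by simp; omega))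

end Growth

/-! ### Integrality of the Artin-Hasse exponential -/

section Integrality

variable (p : ℕ) [hp : Fact p.Prime]

/-- Legendre: `v_p(n!) < n` for `n ≠ 0`. Hence `exp(pT)` is congruent to `1` modulo `p`. -/
lemma norm_pow_div_factorial_le {n : ℕ} (hn : n ≠ 0) :
    ‖(p : ℚ_[p]) ^ n / (n.factorial : ℚ_[p])‖ ≤ (p : ℝ)⁻¹ := by
  have hf : (n.factorial : ℚ_[p]) ≠ 0 := Nat.cast_ne_zero.2 n.factorial_ne_zero
  have hp0 : (0 : ℝ) < p := Nat.cast_pos.2 hp.out.pos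
  rw [norm_div, norm_pow, Padic.norm_p, Padic.norm_eq_zpow_neg_valuation hf,
    Padic.valuation_natCast, zpow_neg, zpow_natCast, div_inv_eq_mul, inv_pow]
  obtain ⟨k, hk⟩ := Nat.exists_eq_add_of_lt (padicValNat_factorial_lt_of_ne_zero p hn)
  have h1 : (1 : ℝ) ≤ (p : ℝ) ^ k :=
    one_le_pow₀ (Nat.one_le_cast.2 hp.out.one_lt.le)
  set v := padicValNat p n.factorial
  rw [hk, pow_succ, pow_add, mul_inv, mul_inv, mul_assoc, mul_comm _ ((p : ℝ) ^ v), mul_assoc,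
    mul_comm ((p : ℝ) ^ v)⁻¹]
  have hv : (p : ℝ) ^ v ≠ 0 := pow_ne_zero _ hp0.ne'
  have : ((p : ℝ) ^ k)⁻¹ ≤ 1 := inv_le_one_of_one_le₀ h1
  have hpi : (0 : ℝ) ≤ (p : ℝ)⁻¹ := inv_nonneg.2 hp0.le
  calc _ = ((p : ℝ) ^ k)⁻¹ * (p : ℝ)⁻¹ := by field_simp
    _ ≤ (p : ℝ)⁻¹ := mul_le_of_le_one_left hpi this

lemma coeff_fexp_nsmul_X (n : ℕ) :
    PowerSeries.coeff n (fexp ((p : ℕ) • PowerSeries.X : ℚ_[p]⟦X⟧))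
      = (p : ℚ_[p]) ^ n / (n.factorial : ℚ_[p]) := by
  have h : ((p : ℕ) • PowerSeries.X : ℚ_[p]⟦X⟧) = PowerSeries.monomial 1 (p : ℚ_[p]) := by
    ext m
    rw [map_nsmul, PowerSeries.coeff_X, PowerSeries.coeff_monomial]
    split_ifs <;> simp
  have h2 := coeff_dilate one_ne_zero (p : ℚ_[p]) (PowerSeries.exp ℚ_[p]) n
  rw [if_pos (one_dvd n), Nat.div_one, PowerSeries.coeff_exp] at h2
  rw [fexp, h]
  refine h2.trans ?_
  simp
  ring

/-- The binomial congruence: if `g` has constant coefficient `1`, then the coefficient of degree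
`n` of `(g + T ^ n h) ^ p` is that of `g ^ p` plus `p` times the constant coefficient of `h`. -/
lemma coeff_add_X_pow_mul_pow {R : Type*} [CommRing R] {n : ℕ} (hn : n ≠ 0) (g h : R⟦X⟧)
    (hg : PowerSeries.constantCoeff g = 1) (q : ℕ) :
    PowerSeries.coeff n ((g + PowerSeries.X ^ n * h) ^ q)
      = PowerSeries.coeff n (g ^ q) + q * PowerSeries.constantCoeff h := by
  obtain ⟨k, hk⟩ := Polynomial.powAddExpansion g (PowerSeries.X ^ n * h) q
  have h1 : (g + PowerSeries.X ^ n * h) ^ q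
      = g ^ q + PowerSeries.X ^ n * ((q : R⟦X⟧) * g ^ (q - 1) * h)
      + PowerSeries.X ^ (n + 1) * (PowerSeries.X ^ (n - 1) * (k * h ^ 2)) := by
    rw [hk]
    have : (PowerSeries.X : R⟦X⟧) ^ (n + 1) * PowerSeries.X ^ (n - 1)
        = PowerSeries.X ^ n * PowerSeries.X ^ n := by
      rw [← pow_add, ← pow_add]
      congr 1
      omega
    linear_combination (-(k * h ^ 2)) * this
  rw [h1, map_add, map_add, PowerSeries.coeff_X_pow_mul', PowerSeries.coeff_X_pow_mul',
    if_pos le_rfl, if_neg (by omega), Nat.sub_self, PowerSeries.coeff_zero_eq_constantCoeff_apply,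
    map_mul, map_mul, map_pow PowerSeries.constantCoeff, hg, one_pow, mul_one, add_zero,
    map_natCast]

/-- Over the `p`-adic integers, `G ^ p` and `G(T ^ p)` are congruent modulo `p`. -/
lemma norm_coeff_expand_sub_pow_le (G : ℤ_[p][X]) (n : ℕ) :
    ‖(Polynomial.expand ℤ_[p] p G - G ^ p).coeff n‖ ≤ (p : ℝ)⁻¹ := by
  have h1 : (Polynomial.expand ℤ_[p] p G - G ^ p).map PadicInt.toZMod = 0 := by
    rw [Polynomial.map_sub, Polynomial.map_pow, Polynomial.map_expand, ZMod.expand_card, sub_self]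
  have h2 : PadicInt.toZMod ((Polynomial.expand ℤ_[p] p G - G ^ p).coeff n) = 0 := by
    rw [← Polynomial.coeff_map, h1, Polynomial.coeff_zero]
  rw [← RingHom.mem_ker, PadicInt.ker_toZMod, PadicInt.maximalIdeal_eq_span_p] at h2
  have h3 := (PadicInt.norm_le_pow_iff_mem_span_pow
    ((Polynomial.expand ℤ_[p] p G - G ^ p).coeff n) 1).2 (by rwa [pow_one])
  simpa using h3

lemma exists_padicInt_poly (f : ℚ_[p]⟦X⟧) (n : ℕ)
    (hf : ∀ i < n, ‖PowerSeries.coeff i f‖ ≤ 1) :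
    ∃ G : ℤ_[p][X], G.map (PadicInt.Coe.ringHom) = PowerSeries.trunc n f := by
  have h : ∀ i, ∃ a : ℤ_[p], i < n → (a : ℚ_[p]) = PowerSeries.coeff i f := by
    intro i
    by_cases hi : i < n
    · exact ⟨⟨_, hf i hi⟩, fun _ => rfl⟩
    · exact ⟨0, fun h => absurd h hi⟩
  choose a ha using h
  refine ⟨∑ i ∈ Finset.range n, Polynomial.monomial i (a i), ?_⟩
  ext i
  simp only [Polynomial.coeff_map, Polynomial.finsetSum_coeff, Polynomial.coeff_monomial,
    PowerSeries.coeff_trunc, Finset.sum_ite_eq', Finset.mem_range]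
  split_ifs with hi
  · exact ha i hi
  · exact map_zero _

/-- **Dwork's criterion**: the case of a power series `f` with `f(T) ^ p = e(T) f(T ^ p)`, where
`e` is congruent to `1` modulo `p`. -/
lemma gaussBound_of_pow_eq {f e : ℚ_[p]⟦X⟧} (hfe : f ^ p = e * dilate p 1 f)
    (hf0 : PowerSeries.constantCoeff f = 1) (he0 : PowerSeries.constantCoeff e = 1)
    (he : ∀ n ≠ 0, ‖PowerSeries.coeff n e‖ ≤ (p : ℝ)⁻¹) : GaussBound 1 1 f := by
  have hpR : (0 : ℝ) < p := Nat.cast_pos.2 hp.out.pos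
  rw [gaussBound_one_iff]
  intro n
  induction n using Nat.strong_induction_on with
  | _ n ih =>
    rcases eq_or_ne n 0 with rfl | hn
    · rw [PowerSeries.coeff_zero_eq_constantCoeff_apply, hf0, norm_one]
    obtain ⟨G, hG⟩ := exists_padicInt_poly p f n ih
    have hGc : ∀ i < n, ((G.coeff i : ℤ_[p]) : ℚ_[p]) = PowerSeries.coeff i f := by
      intro i hi
      have := congrArg (fun q => Polynomial.coeff q i) hG
      simp only [Polynomial.coeff_map, PowerSeries.coeff_trunc, if_pos hi] at this
      exact this
    set g : ℚ_[p]⟦X⟧ := ((PowerSeries.trunc n f : ℚ_[p][X]) : ℚ_[p]⟦X⟧) with hg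
    set h : ℚ_[p]⟦X⟧ := PowerSeries.mk fun i => PowerSeries.coeff (i + n) f with hh
    have hfgh : f = g + PowerSeries.X ^ n * h := by
      ext i
      rw [map_add, hg, Polynomial.coeff_coe, PowerSeries.coeff_trunc, PowerSeries.coeff_X_pow_mul']
      by_cases hi : i < n
      · rw [if_pos hi, if_neg (by omega), add_zero]
      · rw [if_neg hi, if_pos (by omega), hh, PowerSeries.coeff_mk, zero_add,
          Nat.sub_add_cancel (by omega)]
    have hg0 : PowerSeries.constantCoeff g = 1 := by
      rw [← PowerSeries.coeff_zero_eq_constantCoeff_apply, hg, Polynomial.coeff_coe,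
        PowerSeries.coeff_trunc, if_pos (Nat.pos_of_ne_zero hn),
        PowerSeries.coeff_zero_eq_constantCoeff_apply, hf0]
    have hh0 : PowerSeries.constantCoeff h = PowerSeries.coeff n f := by
      rw [← PowerSeries.coeff_zero_eq_constantCoeff_apply, hh, PowerSeries.coeff_mk, zero_add]
    have key := congrArg (PowerSeries.coeff n) hfe
    have hL : PowerSeries.coeff n (f ^ p)
        = ((G ^ p).coeff n : ℤ_[p]) + p * PowerSeries.coeff n f := by
      conv_lhs => rw [hfgh]
      rw [coeff_add_X_pow_mul_pow hn g h hg0, hh0, hg, ← hG, ← Polynomial.coe_pow,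
        ← Polynomial.map_pow, Polynomial.coeff_coe, Polynomial.coeff_map]
      rfl
    -- As `i / p < n`, the coefficients of `f(T ^ p)` up to degree `n` only involve coefficients of
    -- `f` already known to be integral.
    have hdil : ∀ i ≤ n, PowerSeries.coeff i (dilate p 1 f)
        = ((Polynomial.expand ℤ_[p] p G).coeff i : ℤ_[p]) := by
      intro i hi
      rw [coeff_dilate hp.out.ne_zero, Polynomial.coeff_expand hp.out.pos]
      split_ifs with hd
      · rw [one_pow, mul_one, hGc]
        rcases eq_or_ne i 0 with rfl | hi0
        · simpa using Nat.pos_of_ne_zero hn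
        · exact (Nat.div_lt_self (Nat.pos_of_ne_zero hi0) hp.out.one_lt).trans_le hi
      · simp
    obtain ⟨m, rfl⟩ := Nat.exists_eq_succ_of_ne_zero hn
    rw [hL, PowerSeries.coeff_mul, Finset.Nat.antidiagonal_succ, Finset.sum_cons, Finset.sum_map,
      PowerSeries.coeff_zero_eq_constantCoeff_apply, he0, one_mul, hdil _ le_rfl] at key
    -- Comparing coefficients of degree `m + 1` isolates `p f_{m+1}`. The rest is divisible by `p`:
    -- the first term by Frobenius modulo `p`, the second by the hypothesis on `e`.
    have hpf : (p : ℚ_[p]) * PowerSeries.coeff (m + 1) f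
        = ((Polynomial.expand ℤ_[p] p G - G ^ p).coeff (m + 1) : ℤ_[p])
          + ∑ x ∈ Finset.HasAntidiagonal.antidiagonal m, PowerSeries.coeff (x.1 + 1) e
            * PowerSeries.coeff x.2 (dilate p 1 f) := by
      rw [Polynomial.coeff_sub, PadicInt.coe_sub]
      have key' : ∀ a b c d : ℚ_[p], a + b = c + d → b = c - a + d := by
        intro a b c d h
        linear_combination h
      exact key' _ _ _ _ key
    have hle : ‖(p : ℚ_[p]) * PowerSeries.coeff (m + 1) f‖ ≤ (p : ℝ)⁻¹ := by
      rw [hpf]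
      refine norm_add_le_of_le (norm_coeff_expand_sub_pow_le p G (m + 1)) ?_
      refine IsUltrametricDist.norm_sum_le_of_forall_le_of_nonneg (inv_nonneg.2 hpR.le) ?_
      intro x hx
      have hx' := Finset.HasAntidiagonal.mem_antidiagonal.1 hx
      rw [norm_mul, hdil _ (by omega)]
      exact (mul_le_of_le_one_right (norm_nonneg _) (PadicInt.norm_le_one _)).trans
        (he _ (Nat.succ_ne_zero _))
    rw [norm_mul, Padic.norm_p] at hle
    exact le_of_mul_le_mul_left (by rwa [mul_one]) (inv_pos.2 hpR)

lemma gaussBound_artinHasse_padic : GaussBound 1 1 (artinHasse p ℚ_[p]) := by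
  refine gaussBound_of_pow_eq p (artinHasse_pow p ℚ_[p]) (constantCoeff_artinHasse p _)
    (constantCoeff_fexp (by simp)) fun n hn => ?_
  rw [coeff_fexp_nsmul_X]
  exact norm_pow_div_factorial_le p hn

variable (C : Type*) [NormedField C] [NormedAlgebra ℚ_[p] C]

lemma norm_natCast_prime_lt_one : ‖(p : C)‖ < 1 := by
  rw [← map_natCast (algebraMap ℚ_[p] C), norm_algebraMap']
  exact Padic.norm_p_lt_one

variable [CharZero C]

lemma gaussBound_artinHasse : GaussBound 1 1 (artinHasse p C) := by
  rw [gaussBound_one_iff]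
  intro n
  rw [← map_artinHasse p ℚ_[p] (algebraMap ℚ_[p] C), PowerSeries.coeff_map, norm_algebraMap']
  exact gaussBound_one_iff.1 (gaussBound_artinHasse_padic p) n

lemma gaussBound_artinHasseInv [IsUltrametricDist C] : GaussBound 1 1 (artinHasseInv p C) :=
  gaussBound_one_of_mul_eq_one (artinHasse_mul_inv p C) (constantCoeff_artinHasse p C)
    (gaussBound_artinHasse p C)

end Integrality

/-! ### Roots of unity of `p`-power order -/

section RootsOfUnity

variable {C : Type*} [NormedField C]

lemma norm_eq_one_of_pow_eq_one_of_ne_zero {z : C} {n : ℕ} (h : z ^ n = 1) (hn : n ≠ 0) :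
    ‖z‖ = 1 := by
  rw [← pow_eq_one_iff_of_nonneg (norm_nonneg z) hn, ← norm_pow, h, norm_one]

variable [IsUltrametricDist C]

lemma norm_pow_sub_one_le {z : C} (hz : ‖z‖ ≤ 1) (n : ℕ) : ‖z ^ n - 1‖ ≤ ‖z - 1‖ := by
  rw [← geom_sum_mul, norm_mul]
  refine mul_le_of_le_one_left (norm_nonneg _) ?_
  refine IsUltrametricDist.norm_sum_le_of_forall_le_of_nonneg zero_le_one fun i _ => ?_
  rw [norm_pow]
  exact pow_le_one₀ (norm_nonneg _) hz

/-- The left side is `(z - 1) ∑ (z ^ i - 1)`, and `z - 1` divides each summand again. All the errors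
modulo `(z - 1) ^ 2` come from here. -/
lemma norm_pow_sub_one_sub_le {z : C} (hz : ‖z‖ ≤ 1) (n : ℕ) :
    ‖z ^ n - 1 - n * (z - 1)‖ ≤ ‖z - 1‖ * ‖z - 1‖ := by
  have h : z ^ n - 1 - n * (z - 1) = (∑ i ∈ Finset.range n, (z ^ i - 1)) * (z - 1) := by
    rw [Finset.sum_sub_distrib, sub_mul, geom_sum_mul]
    simp
  rw [h, norm_mul]
  refine mul_le_mul_of_nonneg_right ?_ (norm_nonneg _)
  exact IsUltrametricDist.norm_sum_le_of_forall_le_of_nonneg (norm_nonneg _)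
    fun i _ => norm_pow_sub_one_le hz i

variable {p : ℕ}

/-- Modulo `(z - 1) ^ 2` one has `z ^ p - 1 = p (z - 1)`, and both this term and the error are
smaller than `z - 1`. -/
lemma norm_pow_prime_sub_one_lt (hpC : ‖(p : C)‖ < 1) {z : C} (hz : ‖z‖ ≤ 1) (hz1 : ‖z - 1‖ < 1)
    (hne : z ≠ 1) : ‖z ^ p - 1‖ < ‖z - 1‖ := by
  have hpos : 0 < ‖z - 1‖ := norm_pos_iff.2 (sub_ne_zero.2 hne)
  have h : z ^ p - 1 = (z ^ p - 1 - p * (z - 1)) + p * (z - 1) := by ring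
  rw [h]
  refine norm_add_lt_of_lt ((norm_pow_sub_one_sub_le hz p).trans_lt ?_) ?_
  · exact mul_lt_of_lt_one_left hpos hz1
  · rw [norm_mul]
    exact mul_lt_of_lt_one_left hpos hpC

lemma norm_pow_prime_pow_sub_one_lt (hpC : ‖(p : C)‖ < 1) {z : C} (hz : ‖z‖ ≤ 1)
    (hz1 : ‖z - 1‖ < 1) (hne : z ≠ 1) {j : ℕ} (hj : j ≠ 0) : ‖z ^ p ^ j - 1‖ < ‖z - 1‖ := by
  obtain ⟨k, rfl⟩ := Nat.exists_eq_succ_of_ne_zero hj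
  rw [Nat.succ_eq_add_one, pow_succ', pow_mul]
  refine (norm_pow_sub_one_le ?_ _).trans_lt (norm_pow_prime_sub_one_lt hpC hz hz1 hne)
  rw [norm_pow]
  exact pow_le_one₀ (norm_nonneg _) hz

variable [hp : Fact p.Prime]

/-- Frobenius: `(z - 1) ^ p` and `z ^ p - 1` are congruent modulo `p`. -/
lemma norm_sub_one_lt_of_pow_prime (hpC : ‖(p : C)‖ < 1) {z : C} (hz : ‖z‖ ≤ 1)
    (h : ‖z ^ p - 1‖ < 1) : ‖z - 1‖ < 1 := by
  have hx : ‖z - 1‖ ≤ 1 := norm_sub_le_of_le hz norm_one.le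
  have h1 := add_pow_prime_eq' hp.out (z - 1) 1
  rw [sub_add_cancel, one_pow] at h1
  set S := ∑ k ∈ Finset.Ioo 0 p, (z - 1) ^ k * 1 ^ (p - k) * ((p.choose k / p : ℕ) : C) with hS
  have hSn : ‖S‖ ≤ 1 := by
    refine IsUltrametricDist.norm_sum_le_of_forall_le_of_nonneg zero_le_one fun i _ => ?_
    rw [one_pow, mul_one, norm_mul, norm_pow]
    exact mul_le_one₀ (pow_le_one₀ (norm_nonneg _) hx) (norm_nonneg _)
      (IsUltrametricDist.norm_natCast_le_one C _)
  have h2 : (z - 1) ^ p = (z ^ p - 1) + -(p * S) := by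
    rw [h1]
    ring
  have h3 : ‖(z - 1) ^ p‖ < 1 := by
    rw [h2]
    refine norm_add_lt_of_lt h ?_
    rw [norm_neg, norm_mul]
    exact (mul_le_of_le_one_right (norm_nonneg _) hSn).trans_lt hpC
  rw [norm_pow] at h3
  exact (pow_lt_one_iff_of_nonneg (norm_nonneg _) hp.out.ne_zero).1 h3

lemma norm_sub_one_lt_of_pow_prime_pow_eq_one (hpC : ‖(p : C)‖ < 1) {z : C} (j : ℕ)
    (h : z ^ p ^ j = 1) : ‖z - 1‖ < 1 := by
  induction j generalizing z with
  | zero =>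
    rw [pow_zero, pow_one] at h
    simp [h]
  | succ j ih =>
    have hz : ‖z‖ = 1 := norm_eq_one_of_pow_eq_one_of_ne_zero h (pow_ne_zero _ hp.out.ne_zero)
    refine norm_sub_one_lt_of_pow_prime hpC hz.le (ih ?_)
    rw [← pow_mul, ← pow_succ', h]

end RootsOfUnity

/-! ### The exponentials `E(z c T ^ n) / E(c T ^ n)`, for `E` the Artin-Hasse exponential -/

section Quotient

variable (p : ℕ) [hp : Fact p.Prime] {C : Type*} [NormedField C] [CharZero C]

/-- The power series `E(z c T ^ n) / E(c T ^ n)`. -/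
noncomputable def ahQuot (n : ℕ) (z c : C) : C⟦X⟧ :=
  dilate n (z * c) (artinHasse p C) * dilate n c (artinHasseInv p C)

/-- The power series `E(c T ^ n) / E(z c T ^ n)`. -/
noncomputable def ahQuotInv (n : ℕ) (z c : C) : C⟦X⟧ :=
  dilate n c (artinHasse p C) * dilate n (z * c) (artinHasseInv p C)

variable {n : ℕ}

lemma dilate_artinHasse (hn : n ≠ 0) (c : C) :
    dilate n c (artinHasse p C) = fexp (dilate n c (ahLog p C)) :=
  (fexp_dilate hn c (constantCoeff_ahLog p C)).symm

lemma dilate_artinHasse_mul_inv (hn : n ≠ 0) (c : C) :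
    dilate n c (artinHasse p C) * dilate n c (artinHasseInv p C) = 1 := by
  have hA : PowerSeries.constantCoeff (dilate n c (ahLog p C)) = 0 := by
    rw [constantCoeff_dilate hn, constantCoeff_ahLog]
  rw [artinHasseInv, ← fexp_dilate hn c (constantCoeff_neg_ahLog p C), dilate_artinHasse p hn,
    dilate_neg hn, fexp_mul_fexp_neg hA]

lemma ahQuot_mul_ahQuotInv (hn : n ≠ 0) (z c : C) : ahQuot p n z c * ahQuotInv p n z c = 1 := by
  have h1 := dilate_artinHasse_mul_inv p hn c
  have h2 := dilate_artinHasse_mul_inv p hn (z * c)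
  rw [ahQuot, ahQuotInv]
  linear_combination dilate n (z * c) (artinHasse p C) * dilate n (z * c) (artinHasseInv p C) * h1
    + h2

lemma ahQuot_eq_fexp (hn : n ≠ 0) (z c : C) : ahQuot p n z c
    = fexp (dilate n (z * c) (ahLog p C) - dilate n c (ahLog p C)) := by
  have hA : ∀ c, PowerSeries.constantCoeff (dilate n c (ahLog p C)) = 0 := fun c => by
    rw [constantCoeff_dilate hn, constantCoeff_ahLog]
  rw [fexp_sub (hA _) (hA _), ahQuot, artinHasseInv,
    ← fexp_dilate hn c (constantCoeff_neg_ahLog p C), dilate_neg hn, dilate_artinHasse p hn]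

variable [NormedAlgebra ℚ_[p] C] [IsUltrametricDist C]

lemma gaussBound_ahQuot (hn : n ≠ 0) {s : ℝ} (hs : 0 ≤ s) {z c : C} (hz : ‖z‖ = 1)
    (hc : ‖c‖ * s ^ n ≤ 1) : GaussBound s 1 (ahQuot p n z c) := by
  rw [← mul_one (1 : ℝ)]
  refine (gaussBound_dilate hn ?_ hs (gaussBound_artinHasse p C)).mul hs
    (gaussBound_dilate hn hc hs (gaussBound_artinHasseInv p C))
  rwa [norm_mul, hz, one_mul]

lemma gaussBound_ahQuotInv (hn : n ≠ 0) {s : ℝ} (hs : 0 ≤ s) {z c : C} (hz : ‖z‖ = 1)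
    (hc : ‖c‖ * s ^ n ≤ 1) : GaussBound s 1 (ahQuotInv p n z c) := by
  rw [← mul_one (1 : ℝ)]
  refine (gaussBound_dilate hn hc hs (gaussBound_artinHasse p C)).mul hs
    (gaussBound_dilate hn ?_ hs (gaussBound_artinHasseInv p C))
  rwa [norm_mul, hz, one_mul]

/-- After multiplication by `E`, the series is `E(zT) - E(T) - (z - 1) T E'(T)`, whose coefficient
of degree `m` is `E_m (z ^ m - 1 - m (z - 1))`. -/
lemma gaussBound_dilate_mul_inv_sub {z : C} (hz : ‖z‖ ≤ 1) :
    GaussBound 1 (‖z - 1‖ * ‖z - 1‖) (dilate 1 z (artinHasse p C) * artinHasseInv p C - 1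
      - PowerSeries.C (z - 1) * primePowSeries p C) := by
  have h1 : dilate 1 z (artinHasse p C) * artinHasseInv p C - 1
      - PowerSeries.C (z - 1) * primePowSeries p C
      = (dilate 1 z (artinHasse p C) - artinHasse p C
        - PowerSeries.C (z - 1) * (PowerSeries.X * PowerSeries.derivative C (artinHasse p C)))
        * artinHasseInv p C := by
    rw [X_mul_derivative_artinHasse]
    linear_combination (1 + PowerSeries.C (z - 1) * primePowSeries p C) * artinHasse_mul_inv p C
  rw [h1, ← mul_one (‖z - 1‖ * ‖z - 1‖)]
  refine GaussBound.mul zero_le_one ?_ (gaussBound_artinHasseInv p C)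
  rw [gaussBound_one_iff]
  intro m
  have h2 : PowerSeries.coeff m (dilate 1 z (artinHasse p C) - artinHasse p C
        - PowerSeries.C (z - 1) * (PowerSeries.X * PowerSeries.derivative C (artinHasse p C)))
      = PowerSeries.coeff m (artinHasse p C) * (z ^ m - 1 - m * (z - 1)) := by
    rw [map_sub, map_sub, coeff_dilate one_ne_zero, if_pos (one_dvd _), Nat.div_one,
      PowerSeries.coeff_C_mul]
    cases m with
    | zero =>
      rw [PowerSeries.coeff_zero_X_mul]
      simp
    | succ m =>
      rw [PowerSeries.coeff_succ_X_mul, PowerSeries.coeff_derivative]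
      push_cast
      ring
  rw [h2, norm_mul]
  exact (mul_le_of_le_one_left (norm_nonneg _)
    (gaussBound_one_iff.1 (gaussBound_artinHasse p C) m)).trans (norm_pow_sub_one_sub_le hz m)

open Classical in
/-- The power series `E(z c T ^ n) / E(c T ^ n)` is congruent to
`1 + (z - 1) ∑ c ^ (p ^ k) T ^ (n p ^ k)` modulo `(z - 1) ^ 2`. -/
lemma norm_coeff_ahQuot_sub_le (hn : n ≠ 0) {z c : C} (hz : ‖z‖ ≤ 1) (hc : ‖c‖ ≤ 1) (m : ℕ) :
    ‖PowerSeries.coeff m (ahQuot p n z c - 1)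
      - (if ∃ k, m = n * p ^ k then (z - 1) * c ^ (m / n) else 0)‖ ≤ ‖z - 1‖ * ‖z - 1‖ := by
  set R := dilate 1 z (artinHasse p C) * artinHasseInv p C - 1
      - PowerSeries.C (z - 1) * primePowSeries p C with hR
  have hRb : GaussBound 1 (‖z - 1‖ * ‖z - 1‖) (dilate n c R) :=
    gaussBound_dilate hn (by rwa [one_pow, mul_one]) zero_le_one
      (gaussBound_dilate_mul_inv_sub p hz)
  have hU : ahQuot p n z c = dilate n c (dilate 1 z (artinHasse p C) * artinHasseInv p C) := by
    rw [dilate_mul hn, dilate_dilate_one hn, ahQuot]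
  have hcoeff : PowerSeries.coeff m (ahQuot p n z c - 1)
      - (if ∃ k, m = n * p ^ k then (z - 1) * c ^ (m / n) else 0)
      = PowerSeries.coeff m (dilate n c R) := by
    rw [map_sub, hU, coeff_dilate hn, coeff_dilate hn, hR, map_sub, map_sub,
      PowerSeries.coeff_C_mul, PowerSeries.coeff_one, PowerSeries.coeff_one, primePowSeries,
      PowerSeries.coeff_mk]
    by_cases hd : n ∣ m
    · obtain ⟨k, rfl⟩ := hd
      have hnpos := Nat.pos_of_ne_zero hn
      have hiff : (∃ j, n * k = n * p ^ j) ↔ ∃ j, k = p ^ j := by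
        refine exists_congr fun j => ?_
        rw [Nat.mul_left_cancel_iff hnpos]
      have h0 : n * k = 0 ↔ k = 0 := by simp [hn]
      rw [if_pos (Dvd.intro _ rfl), if_pos (Dvd.intro _ rfl), Nat.mul_div_cancel_left _ hnpos]
      have hpow : (if n * k = 0 then (1 : C) else 0) = (if k = 0 then 1 else 0) * c ^ k := by
        by_cases hk : k = 0
        · simp [hk]
        · rw [if_neg hk, if_neg (mt h0.1 hk), zero_mul]
      rw [hpow]
      by_cases hk : ∃ j, k = p ^ j
      · rw [if_pos hk, if_pos (hiff.2 hk)]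
        ring
      · rw [if_neg hk, if_neg (mt hiff.1 hk)]
        ring
    · rw [if_neg hd, if_neg hd, if_neg, if_neg]
      · ring
      · rintro ⟨k, rfl⟩
        exact hd (Dvd.intro _ rfl)
      · rintro rfl
        exact hd (dvd_zero n)
  rw [hcoeff]
  exact gaussBound_one_iff.1 hRb m

end Quotient

/-! ### Decomposition into Artin-Hasse exponentials -/

section Decomposition

variable (p : ℕ) {C : Type*} [Field C]

/-- The sequence `(c_n)` for which `∑ b_n T ^ n` is the sum of the `∑ (c_n T ^ n) ^ (p ^ k) / p ^ k`
for `n ≥ 1`. -/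
noncomputable def wittCoord (b : ℕ → C) (m : ℕ) : C :=
  b m - ∑ n ∈ (Finset.Ico 1 m).attach,
    PowerSeries.coeff m (dilate n.1 (wittCoord b n.1) (ahLog p C))
termination_by m
decreasing_by exact (Finset.mem_Ico.1 n.2).2

variable (b : ℕ → C)

lemma wittCoord_add_sum (m : ℕ) : wittCoord p b m + ∑ n ∈ Finset.Ico 1 m,
    PowerSeries.coeff m (dilate n (wittCoord p b n) (ahLog p C)) = b m := by
  rw [wittCoord, ← Finset.sum_attach (Finset.Ico 1 m), sub_add_cancel]

lemma sum_coeff_dilate_wittCoord {m N : ℕ} (hm : 1 ≤ m) (hN : m ≤ N) :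
    ∑ n ∈ Finset.Icc 1 N, PowerSeries.coeff m (dilate n (wittCoord p b n) (ahLog p C)) = b m := by
  have hsub : Finset.Icc 1 m ⊆ Finset.Icc 1 N := Finset.Icc_subset_Icc_right hN
  rw [← Finset.sum_subset hsub, ← Finset.Ico_insert_right hm,
    Finset.sum_insert Finset.right_notMem_Ico, coeff_dilate (by omega), if_pos dvd_rfl,
    Nat.div_self hm, coeff_one_ahLog, pow_one, one_mul, wittCoord_add_sum]
  intro n hn hn'
  rw [Finset.mem_Icc] at hn hn'
  rw [coeff_dilate (by omega), if_neg]
  intro hd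
  exact hn' ⟨hn.1, Nat.le_of_dvd hm hd⟩

variable [hp : Fact p.Prime] [CharZero C]

/-- The logarithms of the two sides agree up to degree `N` by the choice of `wittCoord`. -/
lemma coeff_fexp_eq_coeff_prod {B : C⟦X⟧} (hB : PowerSeries.constantCoeff B = 0) {N : ℕ}
    (hb : ∀ i ≤ N, PowerSeries.coeff i B = if i = 0 then 0 else b i) {i : ℕ} (hi : i ≤ N) :
    PowerSeries.coeff i (fexp B) = PowerSeries.coeff i
      (∏ n ∈ Finset.Icc 1 N, dilate n (wittCoord p b n) (artinHasse p C)) := by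
  have hn0 : ∀ n ∈ Finset.Icc 1 N, n ≠ 0 := fun n hn => by
    rw [Finset.mem_Icc] at hn
    omega
  have hc : ∀ n ∈ Finset.Icc 1 N,
      PowerSeries.constantCoeff (dilate n (wittCoord p b n) (ahLog p C)) = 0 := fun n hn => by
    rw [constantCoeff_dilate (hn0 n hn), constantCoeff_ahLog]
  have h : ∏ n ∈ Finset.Icc 1 N, dilate n (wittCoord p b n) (artinHasse p C)
      = fexp (∑ n ∈ Finset.Icc 1 N, dilate n (wittCoord p b n) (ahLog p C)) := by
    rw [fexp_sum _ _ hc]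
    refine Finset.prod_congr rfl fun n hn => ?_
    rw [fexp_dilate (hn0 n hn) _ (constantCoeff_ahLog p C), artinHasse]
  have hs0 : PowerSeries.constantCoeff
      (∑ n ∈ Finset.Icc 1 N, dilate n (wittCoord p b n) (ahLog p C)) = 0 := by
    rw [map_sum]
    exact Finset.sum_eq_zero hc
  rw [h]
  refine coeff_fexp_congr hB hs0 (fun j hj => ?_) i hi
  rw [hb j hj]
  split_ifs with hj0
  · subst hj0
    rw [PowerSeries.coeff_zero_eq_constantCoeff_apply, hs0]
  · rw [map_sum, sum_coeff_dilate_wittCoord p b (Nat.one_le_iff_ne_zero.2 hj0) hj]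

/-- Because `E = 1 + T + ⋯`, the factor `E(c T ^ m)` is `1 + c T ^ m` up to degree `m`. This makes
the passage between the coefficients of `exp(B)` and the `c_n` unitriangular. -/
lemma coeff_mul_dilate_artinHasse {m : ℕ} (hm : m ≠ 0) (c : C) {f : C⟦X⟧}
    (hf : PowerSeries.constantCoeff f = 1) :
    PowerSeries.coeff m (f * dilate m c (artinHasse p C)) = PowerSeries.coeff m f + c := by
  obtain ⟨k, rfl⟩ := Nat.exists_eq_succ_of_ne_zero hm
  rw [mul_comm, PowerSeries.coeff_mul, Finset.Nat.antidiagonal_succ', Finset.sum_cons,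
    coeff_dilate hm, if_pos dvd_rfl, Nat.div_self (Nat.pos_of_ne_zero hm), coeff_one_artinHasse,
    PowerSeries.coeff_zero_eq_constantCoeff_apply, hf, Finset.sum_map]
  rw [Finset.sum_eq_single_of_mem (0, k) (by simp)]
  · have h0 : PowerSeries.coeff 0 (dilate (k + 1) c (artinHasse p C)) = 1 := by
      rw [PowerSeries.coeff_zero_eq_constantCoeff_apply, constantCoeff_dilate hm,
        constantCoeff_artinHasse]
    simp [h0]
    ring
  · rintro ⟨i, j⟩ hij hne
    have hij' := Finset.HasAntidiagonal.mem_antidiagonal.1 hij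
    simp only at hij'
    have hi : ¬ (k + 1 ∣ i) := by
      intro hd
      have : i = 0 := by
        by_contra h0
        have := Nat.le_of_dvd (Nat.pos_of_ne_zero h0) hd
        omega
      subst this
      exact hne (by ext <;> simp; omega)
    simp [coeff_dilate hm, hi]

lemma constantCoeff_prod_dilate_artinHasse (S : Finset ℕ) (hS : ∀ n ∈ S, n ≠ 0) (c : ℕ → C) :
    PowerSeries.constantCoeff (∏ n ∈ S, dilate n (c n) (artinHasse p C)) = 1 := by
  rw [map_prod]
  exact Finset.prod_eq_one fun n hn => by
    rw [constantCoeff_dilate (hS n hn), constantCoeff_artinHasse]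

lemma coeff_fexp_eq_add_wittCoord {B : C⟦X⟧} (hB : PowerSeries.constantCoeff B = 0) {m : ℕ}
    (hm : 1 ≤ m) (hb : ∀ i ≤ m, PowerSeries.coeff i B = if i = 0 then 0 else b i) :
    PowerSeries.coeff m (fexp B) = PowerSeries.coeff m
      (∏ n ∈ Finset.Ico 1 m, dilate n (wittCoord p b n) (artinHasse p C)) + wittCoord p b m := by
  rw [coeff_fexp_eq_coeff_prod p b hB hb le_rfl, ← Finset.Ico_insert_right hm,
    Finset.prod_insert Finset.right_notMem_Ico, mul_comm,
    coeff_mul_dilate_artinHasse p (by omega)]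
  refine constantCoeff_prod_dilate_artinHasse p _ (fun n hn => ?_) _
  rw [Finset.mem_Ico] at hn
  omega

end Decomposition

/-! ### Norms of the parameters of the Artin-Hasse decomposition -/

section DecompositionNorm

/-- Finitely many conditions `‖c_n‖ < 1` can be improved uniformly. -/
lemma exists_one_lt_forall_norm_mul_pow_le {C : Type*} [NormedField C]
    (S : Finset ℕ) (c : ℕ → C) (hc : ∀ n ∈ S, ‖c n‖ < 1)
    {t : ℝ} (ht : 1 < t) : ∃ s, 1 < s ∧ s ≤ t ∧ ∀ n ∈ S, ‖c n‖ * s ^ n ≤ 1 := by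
  have h1 : ∀ᶠ s : ℝ in nhdsWithin 1 (Set.Ioi 1), ∀ n ∈ S, ‖c n‖ * s ^ n ≤ 1 := by
    rw [Filter.eventually_all_finset]
    intro n hn
    have hcont : Filter.Tendsto (fun s : ℝ => ‖c n‖ * s ^ n) (nhds 1) (nhds (‖c n‖ * 1 ^ n)) :=
      (continuous_const.mul (continuous_pow n)).tendsto 1
    rw [one_pow, mul_one] at hcont
    exact nhdsWithin_le_nhds ((hcont.eventually (gt_mem_nhds (hc n hn))).mono fun s hs => hs.le)
  have h2 : ∀ᶠ s : ℝ in nhdsWithin 1 (Set.Ioi 1), s ∈ Set.Ioc 1 t := Ioc_mem_nhdsGT ht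
  obtain ⟨s, hs, hst⟩ := (h1.and h2).exists
  exact ⟨s, hst.1, hst.2, hs⟩

variable (p : ℕ) [hp : Fact p.Prime] {C : Type*} [NormedField C] [NormedAlgebra ℚ_[p] C]
  [IsUltrametricDist C] [CharZero C] (b : ℕ → C)

/-- If `exp(B)` has integral coefficients up to degree `N`, then so does `(c_n)`. -/
lemma norm_wittCoord_le_one {B : C⟦X⟧} (hB : PowerSeries.constantCoeff B = 0) {N : ℕ}
    (hb : ∀ i ≤ N, PowerSeries.coeff i B = if i = 0 then 0 else b i)
    (hint : ∀ i ∈ Finset.Icc 1 N, ‖PowerSeries.coeff i (fexp B)‖ ≤ 1) :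
    ∀ n ∈ Finset.Icc 1 N, ‖wittCoord p b n‖ ≤ 1 := by
  intro n
  induction n using Nat.strong_induction_on with
  | _ n ih =>
    intro hn
    have hn' := Finset.mem_Icc.1 hn
    have h := coeff_fexp_eq_add_wittCoord p b hB hn'.1 fun i hi => hb i (hi.trans hn'.2)
    rw [eq_sub_of_add_eq' h.symm]
    refine norm_sub_le_of_le (hint n hn) ?_
    refine gaussBound_one_iff.1 (GaussBound.prod zero_le_one _ fun i hi => ?_) n
    have hi' := Finset.mem_Ico.1 hi
    refine gaussBound_dilate (by omega) ?_ zero_le_one (gaussBound_artinHasse p C)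
    rw [one_pow, mul_one]
    exact ih i hi'.2 (Finset.mem_Icc.2 ⟨hi'.1, hi'.2.le.trans hn'.2⟩)

/-- If all the `c_n` are topologically nilpotent up to degree `N`, then so are the coefficients
of `exp(B)`. -/
lemma norm_coeff_fexp_lt_one {B : C⟦X⟧} (hB : PowerSeries.constantCoeff B = 0) {N : ℕ}
    (hb : ∀ i ≤ N, PowerSeries.coeff i B = if i = 0 then 0 else b i)
    (hlt : ∀ n ∈ Finset.Icc 1 N, ‖wittCoord p b n‖ < 1) :
    ∀ i ∈ Finset.Icc 1 N, ‖PowerSeries.coeff i (fexp B)‖ < 1 := by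
  intro i hi
  rw [Finset.mem_Icc] at hi
  -- A bound by `1` on a radius `s > 1` yields the strict inequality in positive degrees.
  obtain ⟨s, hs1, -, hs⟩ := exists_one_lt_forall_norm_mul_pow_le _ _ hlt one_lt_two
  have hs0 : 0 ≤ s := zero_le_one.trans hs1.le
  rw [coeff_fexp_eq_coeff_prod p b hB hb hi.2]
  have hG : GaussBound s 1 (∏ n ∈ Finset.Icc 1 N, dilate n (wittCoord p b n) (artinHasse p C)) :=
    GaussBound.prod hs0 _ fun n hn => gaussBound_dilate
      (Nat.one_le_iff_ne_zero.1 (Finset.mem_Icc.1 hn).1) (hs n hn) hs0 (gaussBound_artinHasse p C)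
  have h := hG i
  by_contra hcon
  rw [not_lt] at hcon
  have h2 : 1 < s ^ i := one_lt_pow₀ hs1 (by omega)
  nlinarith

end DecompositionNorm

/-! ### Level indices -/

section Levels

variable {p : ℕ} {D : ℕ}

lemma levelIndex_le {n : ℕ} : levelIndex p D n ≤ levelIndex p D 1 := by
  rw [levelIndex, levelIndex, Nat.div_one]
  exact Nat.log_mono_right (Nat.div_le_self D n)

/-- The subtraction is truncated, in agreement with `Nat.log p 0 = 0` once `n * p ^ k` exceeds `D`.
-/
lemma levelIndex_mul_pow (n k : ℕ) :
    levelIndex p D (n * p ^ k) = levelIndex p D n - k := by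
  rw [levelIndex, levelIndex, ← Nat.div_div_eq_div_mul, Nat.log_div_base_pow]

variable {C : Type*} [Field C] {ζ : C}

lemma levelRoot_pow {n k : ℕ} (hk : k ≤ levelIndex p D n) :
    levelRoot p D ζ n ^ p ^ k = levelRoot p D ζ (n * p ^ k) := by
  have h := levelIndex_le (p := p) (D := D) (n := n)
  rw [levelRoot, levelRoot, levelIndex_mul_pow, ← pow_mul, ← pow_add]
  congr 2
  omega

lemma levelRoot_eq_levelRoot_pow {m n : ℕ} (h : levelIndex p D n ≤ levelIndex p D m) :
    levelRoot p D ζ n = levelRoot p D ζ m ^ p ^ (levelIndex p D m - levelIndex p D n) := by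
  have h' := levelIndex_le (p := p) (D := D) (n := m)
  rw [levelRoot, levelRoot, ← pow_mul, ← pow_add]
  congr 2
  omega

variable [hp : Fact p.Prime]

lemma mul_pow_le_iff {n k : ℕ} (hn : n ∈ Finset.Icc 1 D) :
    n * p ^ k ≤ D ↔ k ≤ levelIndex p D n := by
  rw [Finset.mem_Icc] at hn
  rw [levelIndex, Nat.le_log_iff_pow_le hp.out.one_lt (Nat.div_pos hn.2 hn.1).ne',
    Nat.le_div_iff_mul_le hn.1, mul_comm]

lemma isPrimitiveRoot_levelRoot
    (hζ : IsPrimitiveRoot ζ (p ^ (levelIndex p D 1 + 1))) (n : ℕ) :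
    IsPrimitiveRoot (levelRoot p D ζ n) (p ^ (levelIndex p D n + 1)) := by
  have h := levelIndex_le (p := p) (D := D) (n := n)
  refine hζ.pow (pow_pos hp.out.pos _) ?_
  rw [← pow_add]
  congr 1
  omega

lemma levelRoot_pow_eq_one
    (hζ : IsPrimitiveRoot ζ (p ^ (levelIndex p D 1 + 1))) {n k : ℕ} (hk : levelIndex p D n < k) :
    levelRoot p D ζ n ^ p ^ k = 1 :=
  ((isPrimitiveRoot_levelRoot hζ n).pow_eq_one_iff_dvd _).2 (pow_dvd_pow p hk)

lemma levelRoot_ne_one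
    (hζ : IsPrimitiveRoot ζ (p ^ (levelIndex p D 1 + 1))) (n : ℕ) : levelRoot p D ζ n ≠ 1 :=
  (isPrimitiveRoot_levelRoot hζ n).ne_one (one_lt_pow₀ hp.out.one_lt (Nat.succ_ne_zero _))

end Levels

/-! ### Coefficients of `Q̃` and of its truncated exponential -/

section TildePoly

variable {p D : ℕ} {C : Type*} [Field C]

lemma coeff_tildePoly (ζ : C) (Q : C[X]) (i : ℕ) :
    (tildePoly p D ζ Q).coeff i =
      if i ∈ Finset.Icc 1 D then Q.coeff i / (levelRoot p D ζ i - 1) else 0 := by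
  rw [tildePoly, Polynomial.finsetSum_coeff]
  simp only [Polynomial.coeff_monomial, Finset.sum_ite_eq']

lemma coeff_coe_tildePoly_eq (ζ : C) (Q : C[X]) :
    ∀ i ≤ D, PowerSeries.coeff i (tildePoly p D ζ Q : C⟦X⟧)
      = if i = 0 then 0 else Q.coeff i / (levelRoot p D ζ i - 1) := by
  intro i hi
  rw [Polynomial.coeff_coe, coeff_tildePoly]
  by_cases h : i = 0
  · rw [if_pos h, if_neg]
    rw [Finset.mem_Icc]
    omega
  · rw [if_neg h, if_pos]
    rw [Finset.mem_Icc]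
    omega

lemma constantCoeff_coe_tildePoly (ζ : C) (Q : C[X]) :
    PowerSeries.constantCoeff (tildePoly p D ζ Q : C⟦X⟧) = 0 := by
  rw [← PowerSeries.coeff_zero_eq_constantCoeff_apply, coeff_coe_tildePoly_eq ζ Q 0 (Nat.zero_le _),
    if_pos rfl]

lemma coeff_tildeExp [CharZero C] (ζ : C) (Q : C[X]) {i : ℕ} (hi : i ≤ D) :
    (tildeExp p D ζ Q).coeff i = PowerSeries.coeff i (fexp (tildePoly p D ζ Q : C⟦X⟧)) := by
  rw [tildeExp, PowerSeries.coeff_trunc, if_pos (Nat.lt_succ_of_le hi), formalExp_eq_fexp]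

/-- The parameters of the decomposition of `exp(Q)` into quotients of Artin-Hasse exponentials. -/
noncomputable def param (p D : ℕ) (ζ : C) (Q : C[X]) (n : ℕ) : C :=
  wittCoord p (fun i => Q.coeff i / (levelRoot p D ζ i - 1)) n

end TildePoly

/-! ### First-order expansions -/

/-- First-order expansion of a product of series congruent to `1`. -/
lemma gaussBound_prod_sub_one_sub_sum {C : Type*} [NormedField C] [IsUltrametricDist C]
    {ι : Type*} (S : Finset ι) (f : ι → C⟦X⟧) {ε : ℝ}
    (hε0 : 0 ≤ ε) (hε1 : ε ≤ 1) (hf : ∀ i ∈ S, GaussBound 1 ε (f i - 1)) :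
    GaussBound 1 (ε * ε) (∏ i ∈ S, f i - 1 - ∑ i ∈ S, (f i - 1)) := by
  classical
  have hadd : ∀ {M : ℝ} {u v : C⟦X⟧}, GaussBound 1 M u → GaussBound 1 M v →
      GaussBound 1 M (u + v) := by
    intro M u v hu hv
    rw [gaussBound_one_iff] at *
    intro n
    rw [map_add]
    exact norm_add_le_of_le (hu n) (hv n)
  have hmono : ∀ {M N : ℝ} {u : C⟦X⟧}, GaussBound 1 M u → M ≤ N → GaussBound 1 N u :=
    fun hu hMN n => (hu n).trans hMN
  induction S using Finset.induction_on with
  | empty =>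
    rw [gaussBound_one_iff]
    intro n
    simp only [Finset.prod_empty, Finset.sum_empty, sub_self, map_zero, norm_zero]
    exact mul_nonneg hε0 hε0
  | insert a S ha ih =>
    have ih' := ih fun i hi => hf i (Finset.mem_insert_of_mem hi)
    have ha' := hf a (Finset.mem_insert_self _ _)
    have hsum : GaussBound 1 ε (∑ i ∈ S, (f i - 1)) := by
      rw [gaussBound_one_iff]
      intro n
      rw [map_sum]
      exact IsUltrametricDist.norm_sum_le_of_forall_le_of_nonneg hε0 fun i hi =>
        gaussBound_one_iff.1 (hf i (Finset.mem_insert_of_mem hi)) n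
    have hprod : GaussBound 1 ε (∏ i ∈ S, f i - 1) := by
      have h := hadd (hmono ih' (mul_le_of_le_one_left hε0 hε1)) hsum
      rwa [sub_add_cancel] at h
    have h := hadd (ha'.mul zero_le_one hprod) ih'
    rw [Finset.prod_insert ha, Finset.sum_insert ha]
    convert h using 1
    ring

/-! ### Factorization of `exp(Q)` -/

section Factorization

variable {p : ℕ} [hp : Fact p.Prime] {D : ℕ}

/-- In degree `m = n p ^ k` the factor is `z_n ^ (p ^ k) - 1`. The order of `z_n` is chosen so that
`z_n ^ (p ^ k)` is `z_m`, whatever `n` is, as long as `m ≤ D`, and `1` afterwards. The case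
distinction is needed because `levelRoot` itself is never `1`, even in degrees above `D`. -/
lemma coeff_dilate_levelRoot_mul_sub {C : Type*} [Field C] {ζ : C}
    (hζ : IsPrimitiveRoot ζ (p ^ (levelIndex p D 1 + 1))) {n : ℕ} (hn : n ∈ Finset.Icc 1 D)
    (c : C) (m : ℕ) :
    PowerSeries.coeff m (dilate n (levelRoot p D ζ n * c) (ahLog p C) - dilate n c (ahLog p C))
      = (if m ≤ D then levelRoot p D ζ m - 1 else 0)
        * PowerSeries.coeff m (dilate n c (ahLog p C)) := by
  have hnpos : 0 < n := (Finset.mem_Icc.1 hn).1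
  rw [map_sub, coeff_dilate hnpos.ne', coeff_dilate hnpos.ne']
  by_cases hd : n ∣ m
  swap
  · rw [if_neg hd, if_neg hd, mul_zero, sub_zero]
  obtain ⟨q, rfl⟩ := hd
  rw [if_pos (Dvd.intro _ rfl), if_pos (Dvd.intro _ rfl), Nat.mul_div_cancel_left _ hnpos, ahLog,
    PowerSeries.coeff_mk]
  split_ifs with hq hD hD
  · obtain ⟨k, rfl⟩ := hq
    rw [mul_pow, levelRoot_pow ((mul_pow_le_iff hn).1 hD)]
    ring
  · obtain ⟨k, rfl⟩ := hq
    rw [mul_pow, levelRoot_pow_eq_one hζ (not_le.1 (mt (mul_pow_le_iff hn).2 hD))]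
    ring
  · ring
  · ring

variable {C : Type*} [NormedField C] {ζ : C}

lemma norm_levelRoot (hζ : IsPrimitiveRoot ζ (p ^ (levelIndex p D 1 + 1))) (n : ℕ) :
    ‖levelRoot p D ζ n‖ = 1 :=
  norm_eq_one_of_pow_eq_one_of_ne_zero (isPrimitiveRoot_levelRoot hζ n).pow_eq_one
    (pow_ne_zero _ hp.out.ne_zero)

lemma norm_levelRoot_sub_one_lt {C : Type*} [NormedField C]
    [NormedAlgebra ℚ_[p] C] [IsUltrametricDist C] {ζ : C}
    (hζ : IsPrimitiveRoot ζ (p ^ (levelIndex p D 1 + 1))) (n : ℕ) :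
    ‖levelRoot p D ζ n - 1‖ < 1 :=
  norm_sub_one_lt_of_pow_prime_pow_eq_one (norm_natCast_prime_lt_one p C) _
    (isPrimitiveRoot_levelRoot hζ n).pow_eq_one

/-- The root of lower level is a `p ^ j`-th power, `j > 0`, of the other one, and such powers move
strictly closer to `1`. -/
lemma norm_levelRoot_sub_one_lt_of_lt {C : Type*} [NormedField C]
    [NormedAlgebra ℚ_[p] C] [IsUltrametricDist C] {ζ : C}
    (hζ : IsPrimitiveRoot ζ (p ^ (levelIndex p D 1 + 1)))
    {m n : ℕ} (h : levelIndex p D n < levelIndex p D m) :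
    ‖levelRoot p D ζ n - 1‖ < ‖levelRoot p D ζ m - 1‖ := by
  rw [levelRoot_eq_levelRoot_pow h.le]
  exact norm_pow_prime_pow_sub_one_lt (norm_natCast_prime_lt_one p C) (norm_levelRoot hζ m).le
    (norm_levelRoot_sub_one_lt hζ m) (levelRoot_ne_one hζ m) (by omega)

variable [CharZero C]

/-- The factor `z_m - 1` in the logarithm depends only on the degree `m`, so it comes out of the sum
over `n` and cancels the denominator of `Q̃`. The identity is exact, not just up to degree `D`,
since the logarithm of the product vanishes beyond `D`. -/
lemma fexp_eq_prod_ahQuot (hζ : IsPrimitiveRoot ζ (p ^ (levelIndex p D 1 + 1))) {Q : C[X]}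
    (hQ0 : Q.coeff 0 = 0) (hQ : Q.natDegree ≤ D) :
    fexp (Q : C⟦X⟧)
      = ∏ n ∈ Finset.Icc 1 D, ahQuot p n (levelRoot p D ζ n) (param p D ζ Q n) := by
  have hn0 : ∀ n ∈ Finset.Icc 1 D, n ≠ 0 := fun n hn =>
    Nat.one_le_iff_ne_zero.1 (Finset.mem_Icc.1 hn).1
  have hsum : (Q : C⟦X⟧) = ∑ n ∈ Finset.Icc 1 D,
      (dilate n (levelRoot p D ζ n * param p D ζ Q n) (ahLog p C)
        - dilate n (param p D ζ Q n) (ahLog p C)) := by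
    ext m
    rw [map_sum, Polynomial.coeff_coe,
      Finset.sum_congr rfl fun n hn => coeff_dilate_levelRoot_mul_sub hζ hn (param p D ζ Q n) m,
      ← Finset.mul_sum]
    split_ifs with hm
    · rcases eq_or_ne m 0 with rfl | hm0
      · rw [hQ0, Finset.sum_eq_zero, mul_zero]
        intro n hn
        rw [PowerSeries.coeff_zero_eq_constantCoeff_apply, constantCoeff_dilate (hn0 n hn),
          constantCoeff_ahLog]
      · simp only [param]
        rw [sum_coeff_dilate_wittCoord p _ (Nat.one_le_iff_ne_zero.2 hm0) hm,
          mul_div_cancel₀ _ (sub_ne_zero.2 (levelRoot_ne_one hζ m))]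
    · rw [zero_mul, Polynomial.coeff_eq_zero_of_natDegree_lt (by omega)]
  rw [hsum, fexp_sum]
  · exact Finset.prod_congr rfl fun n hn => (ahQuot_eq_fexp p (hn0 n hn) _ _).symm
  · intro n hn
    rw [map_sub, constantCoeff_dilate (hn0 n hn), constantCoeff_dilate (hn0 n hn),
      constantCoeff_ahLog, sub_zero]

variable [NormedAlgebra ℚ_[p] C] [IsUltrametricDist C]

lemma norm_param_le_one {Q : C[X]}
    (h : ∀ i ∈ Finset.Icc 1 D, ‖(tildeExp p D ζ Q).coeff i‖ ≤ 1) :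
    ∀ n ∈ Finset.Icc 1 D, ‖param p D ζ Q n‖ ≤ 1 :=
  norm_wittCoord_le_one p _ (constantCoeff_coe_tildePoly ζ Q) (coeff_coe_tildePoly_eq ζ Q)
    fun i hi => by
      rw [← coeff_tildeExp ζ Q (Finset.mem_Icc.1 hi).2]
      exact h i hi

lemma exists_norm_param_eq_one {Q : C[X]}
    (h : ∀ i ∈ Finset.Icc 1 D, ‖(tildeExp p D ζ Q).coeff i‖ ≤ 1)
    (h' : ∃ i ∈ Finset.Icc 1 D, ‖(tildeExp p D ζ Q).coeff i‖ = 1) :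
    ∃ n ∈ Finset.Icc 1 D, ‖param p D ζ Q n‖ = 1 := by
  by_contra! hcon
  obtain ⟨i, hi, hi1⟩ := h'
  have hlt : ∀ n ∈ Finset.Icc 1 D, ‖param p D ζ Q n‖ < 1 := fun n hn =>
    lt_of_le_of_ne (norm_param_le_one h n hn) (hcon n hn)
  have := norm_coeff_fexp_lt_one p _ (constantCoeff_coe_tildePoly ζ Q)
    (coeff_coe_tildePoly_eq ζ Q) hlt i hi
  rw [← coeff_tildeExp ζ Q (Finset.mem_Icc.1 hi).2, hi1] at this
  exact lt_irrefl _ this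

/-- If `exp(Q̃)` has integral coefficients up to degree `D`, then `exp(Q)` has integral
coefficients. -/
theorem gaussBound_fexp_of_tildeExp (hζ : IsPrimitiveRoot ζ (p ^ (levelIndex p D 1 + 1)))
    {Q : C[X]} (hQ0 : Q.coeff 0 = 0) (hQ : Q.natDegree ≤ D)
    (h : ∀ i ∈ Finset.Icc 1 D, ‖(tildeExp p D ζ Q).coeff i‖ ≤ 1) :
    GaussBound 1 1 (fexp (Q : C⟦X⟧)) := by
  rw [fexp_eq_prod_ahQuot hζ hQ0 hQ]
  refine GaussBound.prod zero_le_one _ fun n hn => ?_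
  refine gaussBound_ahQuot p (Nat.one_le_iff_ne_zero.1 (Finset.mem_Icc.1 hn).1) zero_le_one
    (norm_levelRoot hζ n) ?_
  rw [one_pow, mul_one]
  exact norm_param_le_one h n hn

/-! ### Optimality -/

/-- If moreover `exp(Q̃)` has a unit coefficient in some degree between `1` and `D`, then
`exp(Q)` does not converge in a disc of radius greater than `1`. -/
theorem not_gaussBound_fexp_of_tildeExp (hζ : IsPrimitiveRoot ζ (p ^ (levelIndex p D 1 + 1)))
    {Q : C[X]} (hQ0 : Q.coeff 0 = 0) (hQ : Q.natDegree ≤ D)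
    (h : ∀ i ∈ Finset.Icc 1 D, ‖(tildeExp p D ζ Q).coeff i‖ ≤ 1)
    (h' : ∃ i ∈ Finset.Icc 1 D, ‖(tildeExp p D ζ Q).coeff i‖ = 1) {t M : ℝ} (ht : 1 < t) :
    ¬ GaussBound t M (fexp (Q : C⟦X⟧)) := by
  classical
  intro hG
  set c := param p D ζ Q with hc
  set z := levelRoot p D ζ with hz
  set d := levelIndex p D with hd
  have hc1 := norm_param_le_one h
  rw [← hc] at hc1
  have hn0 : ∀ n ∈ Finset.Icc 1 D, n ≠ 0 := fun n hn =>
    Nat.one_le_iff_ne_zero.1 (Finset.mem_Icc.1 hn).1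
  -- Among the unit parameters, the largest level gives the largest `‖z n - 1‖`, hence the dominant
  -- factor.
  obtain ⟨n₀, hn₀, hmax⟩ := ((Finset.Icc 1 D).filter fun n => ‖c n‖ = 1).exists_max_image d (by
    obtain ⟨n, hn, hn1⟩ := exists_norm_param_eq_one h h'
    exact ⟨n, Finset.mem_filter.2 ⟨hn, hn1⟩⟩)
  obtain ⟨hn₀D, hcn₀⟩ := Finset.mem_filter.1 hn₀
  set S := (Finset.Icc 1 D).filter fun n => d n ≤ d n₀ with hS
  set S' := (Finset.Icc 1 D).filter fun n => ¬ d n ≤ d n₀ with hS'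
  have hS'lt : ∀ n ∈ S', ‖c n‖ < 1 := by
    intro n hn
    obtain ⟨hnD, hnd⟩ := Finset.mem_filter.1 hn
    exact lt_of_le_of_ne (hc1 n hnD) fun h1 => hnd (hmax n (Finset.mem_filter.2 ⟨hnD, h1⟩))
  obtain ⟨s, hs1, hst, hs⟩ := exists_one_lt_forall_norm_mul_pow_le S' c hS'lt ht
  have hs0 : 0 ≤ s := zero_le_one.trans hs1.le
  -- The factors in `S'` could have larger `‖z n - 1‖`, but their parameters have norm `< 1`;
  -- dividing them out preserves a bound on the radius `s > 1`.
  have hF : fexp (Q : C⟦X⟧) * ∏ n ∈ S', ahQuotInv p n (z n) (c n)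
      = ∏ n ∈ S, ahQuot p n (z n) (c n) := by
    rw [fexp_eq_prod_ahQuot hζ hQ0 hQ,
      ← Finset.prod_filter_mul_prod_filter_not (Finset.Icc 1 D) fun n => d n ≤ d n₀, mul_assoc,
      ← Finset.prod_mul_distrib, Finset.prod_eq_one (s := S'), mul_one]
    intro n hn
    exact ahQuot_mul_ahQuotInv p (hn0 n (Finset.mem_filter.1 hn).1) _ _
  have hbound : GaussBound s M (∏ n ∈ S, ahQuot p n (z n) (c n)) := by
    rw [← hF, ← mul_one M]
    refine (hG.anti hs0 hst).mul hs0 (GaussBound.prod hs0 _ fun n hn => ?_)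
    exact gaussBound_ahQuotInv p (hn0 n (Finset.mem_filter.1 hn).1) hs0 (norm_levelRoot hζ n)
      (hs n hn)
  set ε := ‖z n₀ - 1‖ with hε
  have hε0 : 0 < ε := norm_pos_iff.2 (sub_ne_zero.2 (levelRoot_ne_one hζ n₀))
  have hε1 : ε < 1 := norm_levelRoot_sub_one_lt hζ n₀
  have hεε : ε * ε < ε := mul_lt_of_lt_one_left hε0 hε1
  have hzle : ∀ n ∈ S, ‖z n - 1‖ ≤ ε := by
    intro n hn
    have hle : d n ≤ d n₀ := (Finset.mem_filter.1 hn).2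
    rcases hle.lt_or_eq with hlt | heq
    · exact (norm_levelRoot_sub_one_lt_of_lt hζ hlt).le
    · have : z n = z n₀ := by
        rw [hz, levelRoot, levelRoot]
        rw [hd] at heq
        rw [heq]
      rw [this]
  have happrox : ∀ n ∈ S, ∀ m, ‖PowerSeries.coeff m (ahQuot p n (z n) (c n) - 1)
      - (if ∃ k, m = n * p ^ k then (z n - 1) * c n ^ (m / n) else 0)‖ < ε := by
    intro n hn m
    have hnD := (Finset.mem_filter.1 hn).1
    refine (norm_coeff_ahQuot_sub_le p (hn0 n hnD) (norm_levelRoot hζ n).le (hc1 n hnD) m).trans_lt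
      (lt_of_le_of_lt ?_ hεε)
    exact mul_le_mul (hzle n hn) (hzle n hn) (norm_nonneg _) hε0.le
  have hone : ∀ n ∈ S, GaussBound 1 ε (ahQuot p n (z n) (c n) - 1) := by
    intro n hn
    rw [gaussBound_one_iff]
    intro m
    rw [← sub_add_cancel (PowerSeries.coeff m (ahQuot p n (z n) (c n) - 1))
      (if ∃ k, m = n * p ^ k then (z n - 1) * c n ^ (m / n) else 0)]
    refine norm_add_le_of_le (happrox n hn m).le ?_
    split_ifs
    · rw [norm_mul, norm_pow]
      exact (mul_le_of_le_one_right (norm_nonneg _) (pow_le_one₀ (norm_nonneg _)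
        (hc1 n (Finset.mem_filter.1 hn).1))).trans (hzle n hn)
    · rw [norm_zero]
      exact hε0.le
  have hn₀S : n₀ ∈ S := Finset.mem_filter.2 ⟨hn₀D, le_rfl⟩
  have hn₀pos : 0 < n₀ := Nat.pos_of_ne_zero (hn0 n₀ hn₀D)
  -- The coefficients of degree `n₀ p ^ k` all have the same norm.
  have hcoeff : ∀ k, ‖PowerSeries.coeff (n₀ * p ^ k) (∏ n ∈ S, ahQuot p n (z n) (c n))‖ = ε := by
    intro k
    set m := n₀ * p ^ k with hm
    have hm0 : m ≠ 0 := (Nat.mul_pos hn₀pos (pow_pos hp.out.pos k)).ne'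
    have h0 : ‖PowerSeries.coeff m (ahQuot p n₀ (z n₀) (c n₀) - 1)‖ = ε := by
      have h1 := happrox n₀ hn₀S m
      rw [if_pos ⟨k, hm⟩] at h1
      have h2 : ‖(z n₀ - 1) * c n₀ ^ (m / n₀)‖ = ε := by
        rw [norm_mul, norm_pow, hcn₀, one_pow, mul_one]
      rw [← h2] at h1
      rw [← h2, ← norm_add_eq_of_lt h1, add_sub_cancel]
    have hother : ∀ n ∈ S.erase n₀,
        ‖PowerSeries.coeff m (ahQuot p n (z n) (c n) - 1)‖ < ε := by
      intro n hn
      obtain ⟨hne, hnS⟩ := Finset.mem_erase.1 hn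
      obtain ⟨hnD, hnd⟩ := Finset.mem_filter.1 hnS
      have h1 := happrox n hnS m
      split_ifs at h1 with hex
      · rw [← sub_add_cancel (PowerSeries.coeff m (ahQuot p n (z n) (c n) - 1))
          ((z n - 1) * c n ^ (m / n))]
        refine norm_add_lt_of_lt h1 ?_
        -- If `n p ^ j = n₀ p ^ k`, then `n` and `n₀` differ by a power of `p`. Both are at most
        -- `D`, so their levels differ by exactly that exponent, and equal levels would force `n =
        -- n₀`.
        have hlt : d n < d n₀ := by
          refine lt_of_le_of_ne hnd fun heq => hne ?_
          obtain ⟨j, hj⟩ := hex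
          rw [hm] at hj
          rcases le_total j k with hjk | hkj
          · obtain ⟨i, rfl⟩ := Nat.exists_eq_add_of_le hjk
            rw [pow_add, mul_comm (p ^ j), ← mul_assoc] at hj
            have hn' : n₀ * p ^ i = n :=
              Nat.eq_of_mul_eq_mul_right (pow_pos hp.out.pos j) hj
            have hi : i ≤ d n₀ := (mul_pow_le_iff hn₀D).1 (hn' ▸ (Finset.mem_Icc.1 hnD).2)
            have hdn : d n = d n₀ - i := by rw [← hn', hd, levelIndex_mul_pow]
            have hi0 : i = 0 := by omega
            rw [← hn', hi0, pow_zero, mul_one]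
          · obtain ⟨i, rfl⟩ := Nat.exists_eq_add_of_le hkj
            rw [pow_add, mul_comm (p ^ k) (p ^ i), ← mul_assoc] at hj
            have hn' : n₀ = n * p ^ i :=
              Nat.eq_of_mul_eq_mul_right (pow_pos hp.out.pos k) hj
            have hi : i ≤ d n := (mul_pow_le_iff hnD).1 (hn' ▸ (Finset.mem_Icc.1 hn₀D).2)
            have hdn : d n₀ = d n - i := by
              rw [hd, ← levelIndex_mul_pow, ← hn']
            have hi0 : i = 0 := by omega
            rw [hn', hi0, pow_zero, mul_one]
        rw [norm_mul, norm_pow]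
        exact (mul_le_of_le_one_right (norm_nonneg _) (pow_le_one₀ (norm_nonneg _)
          (hc1 n hnD))).trans_lt (norm_levelRoot_sub_one_lt_of_lt hζ hlt)
      · rwa [sub_zero] at h1
    have hR := gaussBound_one_iff.1
      (gaussBound_prod_sub_one_sub_sum S _ hε0.le hε1.le hone) m
    have hsum : PowerSeries.coeff m (ahQuot p n₀ (z n₀) (c n₀) - 1)
        + ∑ n ∈ S.erase n₀, PowerSeries.coeff m (ahQuot p n (z n) (c n) - 1)
        = ∑ n ∈ S, PowerSeries.coeff m (ahQuot p n (z n) (c n) - 1) :=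
      Finset.add_sum_erase S (fun n => PowerSeries.coeff m (ahQuot p n (z n) (c n) - 1)) hn₀S
    have hdecomp : PowerSeries.coeff m (∏ n ∈ S, ahQuot p n (z n) (c n))
        = PowerSeries.coeff m (ahQuot p n₀ (z n₀) (c n₀) - 1)
          + (∑ n ∈ S.erase n₀, PowerSeries.coeff m (ahQuot p n (z n) (c n) - 1)
            + PowerSeries.coeff m (∏ n ∈ S, ahQuot p n (z n) (c n) - 1
              - ∑ n ∈ S, (ahQuot p n (z n) (c n) - 1))) := by
      rw [map_sub _ (_ - 1), map_sub _ (∏ n ∈ S, ahQuot p n (z n) (c n)), map_sum,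
        PowerSeries.coeff_one, if_neg hm0]
      linear_combination -hsum
    rw [hdecomp, norm_add_eq_of_lt, h0]
    rw [h0]
    exact norm_add_lt_of_lt (norm_sum_lt_of_lt hε0 hother) (hR.trans_lt hεε)
  -- Coefficients of constant norm `ε` in the unbounded degrees `n₀ p ^ k` contradict the bound `M`
  -- on the radius `s`.
  obtain ⟨k, hk⟩ := pow_unbounded_of_one_lt (M / ε) hs1
  have hkm : k ≤ n₀ * p ^ k :=
    (Nat.lt_pow_self hp.out.one_lt).le.trans (Nat.le_mul_of_pos_left _ hn₀pos)
  have hlt : M < ε * s ^ (n₀ * p ^ k) := by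
    rw [div_lt_iff₀' hε0] at hk
    exact hk.trans_le (mul_le_mul_of_nonneg_left (pow_le_pow_right₀ hs1.le hkm) hε0.le)
  have hle := hbound (n₀ * p ^ k)
  rw [hcoeff k] at hle
  exact absurd hle (not_le.2 hlt)

end Factorization

/-! ### The radius of convergence -/

section Radius

variable {K : Type*} [NontriviallyNormedField K]

lemma le_radiusOfConvergence {f : K⟦X⟧} {r M : ℝ} (hr : 0 ≤ r) (h : GaussBound r M f) :
    ENNReal.ofReal r ≤ radiusOfConvergence f := by
  lift r to NNReal using hr
  rw [ENNReal.ofReal_coe_nnreal]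
  refine FormalMultilinearSeries.le_radius_of_bound _ M fun n => ?_
  rw [FormalMultilinearSeries.ofScalars_norm]
  exact h n

lemma exists_gaussBound_of_lt_radiusOfConvergence {f : K⟦X⟧} {r : ℝ} (hr : 0 ≤ r)
    (h : ENNReal.ofReal r < radiusOfConvergence f) : ∃ t M : ℝ, r < t ∧ GaussBound t M f := by
  lift r to NNReal using hr
  rw [ENNReal.ofReal_coe_nnreal] at h
  obtain ⟨t, hrt, ht⟩ := ENNReal.lt_iff_exists_nnreal_btwn.1 h
  obtain ⟨M, -, hM⟩ := FormalMultilinearSeries.norm_mul_pow_le_of_lt_radius _ ht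
  refine ⟨t, M, by exact_mod_cast hrt, fun n => ?_⟩
  have := hM n
  rwa [FormalMultilinearSeries.ofScalars_norm] at this

end Radius

/-! ### Compatibility with the substitution of `λT` for `T` -/

section Rescale

variable {F : Type*} [Field F]

lemma coe_comp_C_mul_X (Q : F[X]) (l : F) :
    ((Q.comp (Polynomial.C l * Polynomial.X) : F[X]) : F⟦X⟧) = dilate 1 l (Q : F⟦X⟧) := by
  ext n
  rw [Polynomial.coeff_coe, Polynomial.comp_C_mul_X_coeff, coeff_dilate one_ne_zero,
    if_pos (one_dvd _), Nat.div_one, Polynomial.coeff_coe]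

lemma coeff_fexp_comp [CharZero F] {Q : F[X]} (hQ0 : Q.coeff 0 = 0) (l : F) (n : ℕ) :
    PowerSeries.coeff n (fexp ((Q.comp (Polynomial.C l * Polynomial.X) : F[X]) : F⟦X⟧))
      = PowerSeries.coeff n (fexp (Q : F⟦X⟧)) * l ^ n := by
  rw [coe_comp_C_mul_X, fexp_dilate one_ne_zero _ (by simpa using hQ0), coeff_dilate one_ne_zero,
    if_pos (one_dvd _), Nat.div_one]

lemma tildePoly_comp (p D : ℕ) (ζ l : F) (Q : F[X]) :
    tildePoly p D ζ (Q.comp (Polynomial.C l * Polynomial.X))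
      = (tildePoly p D ζ Q).comp (Polynomial.C l * Polynomial.X) := by
  ext n
  rw [Polynomial.comp_C_mul_X_coeff, coeff_tildePoly, coeff_tildePoly,
    Polynomial.comp_C_mul_X_coeff]
  split_ifs
  · ring
  · rw [zero_mul]

lemma coeff_tildeExp_comp [CharZero F] (p : ℕ) {D : ℕ} (ζ l : F) (Q : F[X]) {i : ℕ} (hi : i ≤ D) :
    (tildeExp p D ζ (Q.comp (Polynomial.C l * Polynomial.X))).coeff i
      = (tildeExp p D ζ Q).coeff i * l ^ i := by
  rw [coeff_tildeExp ζ _ hi, coeff_tildeExp ζ _ hi, tildePoly_comp, coeff_fexp_comp]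
  rw [coeff_tildePoly, if_neg (by simp)]

/-- Some coefficient of `exp(Q̃)` in degrees between `1` and `D` does not vanish. -/
lemma exists_coeff_tildeExp_ne_zero [CharZero F] {p : ℕ} [hp : Fact p.Prime] {D : ℕ} {ζ : F}
    (hζ : IsPrimitiveRoot ζ (p ^ (levelIndex p D 1 + 1))) {Q : F[X]} (hQ0 : Q.coeff 0 = 0)
    (hQ : Q ≠ 0) (hD : Q.natDegree ≤ D) :
    ∃ i ∈ Finset.Icc 1 D, (tildeExp p D ζ Q).coeff i ≠ 0 := by
  by_contra! hcon
  have hB := constantCoeff_coe_tildePoly (p := p) (D := D) ζ Q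
  refine hQ (Polynomial.ext fun m => ?_)
  rw [Polynomial.coeff_zero]
  rcases eq_or_ne m 0 with rfl | hm0
  · exact hQ0
  by_cases hmD : m ≤ D
  swap
  · exact Polynomial.coeff_eq_zero_of_natDegree_lt (by omega)
  obtain ⟨n, rfl⟩ := Nat.exists_eq_succ_of_ne_zero hm0
  have hz : ∀ i, i ≠ 0 → i ≤ D →
      PowerSeries.coeff i (fexp (tildePoly p D ζ Q : F⟦X⟧)) = 0 := fun i hi0 hi => by
    rw [← coeff_tildeExp ζ Q hi]
    exact hcon i (Finset.mem_Icc.2 ⟨Nat.one_le_iff_ne_zero.2 hi0, hi⟩)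
  have h := succ_mul_coeff_fexp hB n
  -- When the coefficients of `exp(Q̃)` vanish in degrees `1` to `D`, only the term with its
  -- constant coefficient survives in the recursion, so the coefficient of `Q̃` in degree `n + 1`
  -- vanishes too.
  rw [hz _ (Nat.succ_ne_zero n) hmD, mul_zero, Finset.sum_eq_single_of_mem (n, 0) (by simp),
    PowerSeries.coeff_zero_eq_constantCoeff_apply, constantCoeff_fexp hB, mul_one,
    coeff_coe_tildePoly_eq ζ Q _ hmD, if_neg (Nat.succ_ne_zero n), eq_comm, mul_eq_zero,
    div_eq_zero_iff, or_iff_left (sub_ne_zero.2 (levelRoot_ne_one hζ _))] at h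
  · exact h.resolve_left (by exact_mod_cast Nat.succ_ne_zero n)
  · rintro ⟨i, j⟩ hij hne
    have hij' : i + j = n := Finset.HasAntidiagonal.mem_antidiagonal.1 hij
    have hj : j ≠ 0 := by
      rintro rfl
      exact hne (by rw [← hij', add_zero])
    rw [hz j hj (by omega), mul_zero]

end Rescale

/-- Over an algebraically closed normed field, the largest radius `‖l‖` at which finitely many
monomials `a_i T ^ i`, not all zero, are bounded by `1`. -/
lemma exists_norm_mul_pow_le_one {C : Type*} [NormedField C] [IsAlgClosed C] {D : ℕ} (a : ℕ → C)
    (ha : ∃ i ∈ Finset.Icc 1 D, a i ≠ 0) :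
    ∃ l : C, l ≠ 0 ∧ (∀ i ∈ Finset.Icc 1 D, ‖a i‖ * ‖l‖ ^ i ≤ 1)
      ∧ ∃ i ∈ Finset.Icc 1 D, ‖a i‖ * ‖l‖ ^ i = 1 := by
  classical
  have hroot : ∀ i, ∃ l : C, i ∈ Finset.Icc 1 D → a i ≠ 0 → l ^ i = (a i)⁻¹ := by
    intro i
    by_cases hi : i ∈ Finset.Icc 1 D
    · obtain ⟨l, hl⟩ := IsAlgClosed.exists_pow_nat_eq (a i)⁻¹ (Finset.mem_Icc.1 hi).1
      exact ⟨l, fun _ _ => hl⟩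
    · exact ⟨0, fun h => absurd h hi⟩
  choose l hl using hroot
  -- Each nonzero `a i` imposes `‖λ‖ ≤ ‖l i‖`; the most restrictive index gives the witness.
  obtain ⟨j, hj, hmin⟩ := ((Finset.Icc 1 D).filter fun i => a i ≠ 0).exists_min_image
    (fun i => ‖l i‖) (by
      obtain ⟨i, hi, hi0⟩ := ha
      exact ⟨i, Finset.mem_filter.2 ⟨hi, hi0⟩⟩)
  obtain ⟨hjD, haj⟩ := Finset.mem_filter.1 hj
  have hone : ∀ i ∈ Finset.Icc 1 D, a i ≠ 0 → ‖a i‖ * ‖l i‖ ^ i = 1 := by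
    intro i hi hi0
    rw [← norm_pow, hl i hi hi0, norm_inv, mul_inv_cancel₀ (norm_ne_zero_iff.2 hi0)]
  refine ⟨l j, ?_, fun i hi => ?_, j, hjD, hone j hjD haj⟩
  · intro h0
    have := hl j hjD haj
    rw [h0, zero_pow (by rw [Finset.mem_Icc] at hjD; omega)] at this
    exact inv_ne_zero haj this.symm
  · by_cases hi0 : a i = 0
    · rw [hi0, norm_zero, zero_mul]
      exact zero_le_one
    · rw [← hone i hi hi0]
      exact mul_le_mul_of_nonneg_left (pow_le_pow_left₀ (norm_nonneg _)
        (hmin i (Finset.mem_filter.2 ⟨hi, hi0⟩)) i) (norm_nonneg _)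

end ExpRadius

/-! ### Reduction of the theorem to radius `1` -/

theorem mainTheorem5 (p : ℕ) [Fact p.Prime]
    {K : Type*} [NontriviallyNormedField K] [NormedAlgebra ℚ_[p] K] [IsUltrametricDist K]
    [CharZero K]
    {C : Type*} [NormedField C] [NormedAlgebra K C] [IsUltrametricDist C] [CharZero C]
    [IsAlgClosed C]
    (L P : K[X]) (hL : L ≠ 0) (hP : Polynomial.derivative P = L) (hP0 : P.coeff 0 = 0)
    (D : ℕ) (hD : D = P.natDegree)
    (ζ : C) (hζ : IsPrimitiveRoot ζ (p ^ (ExpRadius.levelIndex p D 1 + 1))) :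
    ∃ ρ : ℝ, ExpRadius.radiusOfConvergence (ExpRadius.formalExp P) = ENNReal.ofReal ρ ∧
      IsGreatest
        {r : ℝ | ∃ l : C, r = ‖l‖ ∧ ∀ i ∈ Finset.Icc 1 D,
          ‖(ExpRadius.tildeExp p D ζ (P.map (algebraMap K C))).coeff i‖ * ‖l‖ ^ i ≤ 1} ρ := by
  let _ : NormedAlgebra ℚ_[p] C :=
    { ((algebraMap K C).comp (algebraMap ℚ_[p] K)).toAlgebra with
      norm_smul_le := fun r x => by
        change ‖algebraMap K C (algebraMap ℚ_[p] K r) * x‖ ≤ ‖r‖ * ‖x‖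
        rw [norm_mul, norm_algebraMap', norm_algebraMap'] }
  set Q : C[X] := P.map (algebraMap K C) with hQ
  have hPne : P ≠ 0 := by
    rintro rfl
    exact hL (by rw [← hP, Polynomial.derivative_zero])
  have hQ0 : Q.coeff 0 = 0 := by rw [hQ, Polynomial.coeff_map, hP0, map_zero]
  have hQne : Q ≠ 0 := (Polynomial.map_ne_zero_iff (algebraMap K C).injective).2 hPne
  have hQD : Q.natDegree ≤ D := hD ▸ Polynomial.natDegree_map_le
  obtain ⟨l, hl0, hle, heq⟩ := ExpRadius.exists_norm_mul_pow_le_one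
    (fun i => (ExpRadius.tildeExp p D ζ Q).coeff i)
    (ExpRadius.exists_coeff_tildeExp_ne_zero hζ hQ0 hQne hQD)
  have hlpos : 0 < ‖l‖ := norm_pos_iff.2 hl0
  -- The rescaled polynomial has `max ‖ã_i‖ = 1`, so that the integrality and optimality theorems
  -- both apply to it.
  set R : C[X] := Q.comp (Polynomial.C l * Polynomial.X) with hR
  have hR0 : R.coeff 0 = 0 := by rw [hR, Polynomial.comp_C_mul_X_coeff, hQ0, zero_mul]
  have hRD : R.natDegree ≤ D := by
    rw [Polynomial.natDegree_le_iff_coeff_eq_zero]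
    intro n hn
    rw [hR, Polynomial.comp_C_mul_X_coeff,
      Polynomial.coeff_eq_zero_of_natDegree_lt (hQD.trans_lt hn), zero_mul]
  have hnorm : ∀ i ∈ Finset.Icc 1 D, ‖(ExpRadius.tildeExp p D ζ R).coeff i‖
      = ‖(ExpRadius.tildeExp p D ζ Q).coeff i‖ * ‖l‖ ^ i := fun i hi => by
    rw [hR, ExpRadius.coeff_tildeExp_comp p ζ l Q (Finset.mem_Icc.1 hi).2, norm_mul, norm_pow]
  have hRle : ∀ i ∈ Finset.Icc 1 D, ‖(ExpRadius.tildeExp p D ζ R).coeff i‖ ≤ 1 := fun i hi => by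
    rw [hnorm i hi]
    exact hle i hi
  have hReq : ∃ i ∈ Finset.Icc 1 D, ‖(ExpRadius.tildeExp p D ζ R).coeff i‖ = 1 := by
    obtain ⟨i, hi, hi1⟩ := heq
    exact ⟨i, hi, by rw [hnorm i hi, hi1]⟩
  have hcoeff : ∀ n, ‖PowerSeries.coeff n (ExpRadius.fexp (R : C⟦X⟧))‖
      = ‖PowerSeries.coeff n (ExpRadius.formalExp P)‖ * ‖l‖ ^ n := by
    intro n
    have hmap : ExpRadius.fexp (Q : C⟦X⟧)
        = PowerSeries.map (algebraMap K C) (ExpRadius.formalExp P) := by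
      rw [ExpRadius.formalExp_eq_fexp, ExpRadius.map_fexp _ (by simpa using hP0), hQ,
        Polynomial.polynomial_map_coe]
    rw [hR, ExpRadius.coeff_fexp_comp hQ0, hmap, PowerSeries.coeff_map, norm_mul, norm_pow,
      norm_algebraMap']
  refine ⟨‖l‖, le_antisymm ?_ ?_, ⟨l, rfl, hle⟩, ?_⟩
  · by_contra hcon
    obtain ⟨t, M, hlt, hM⟩ := ExpRadius.exists_gaussBound_of_lt_radiusOfConvergence
      (norm_nonneg l) (not_le.1 hcon)
    -- A bound for `exp(P)` on the radius `t > ‖l‖` becomes one for `exp(R)` on the radius `t / ‖l‖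
    -- > 1`.
    refine ExpRadius.not_gaussBound_fexp_of_tildeExp hζ hR0 hRD hRle hReq
      ((one_lt_div hlpos).2 hlt) (M := M) fun n => ?_
    rw [hcoeff, mul_assoc, ← mul_pow, mul_div_cancel₀ _ hlpos.ne']
    exact hM n
  · refine ExpRadius.le_radiusOfConvergence (norm_nonneg l) (M := 1) fun n => ?_
    rw [← hcoeff]
    exact ExpRadius.gaussBound_one_iff.1
      (ExpRadius.gaussBound_fexp_of_tildeExp hζ hR0 hRD hRle) n
  · rintro r ⟨l', rfl, hl'⟩
    obtain ⟨i, hi, hi1⟩ := heq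
    have h := (hl' i hi).trans_eq hi1.symm
    have hpos : 0 < ‖(ExpRadius.tildeExp p D ζ Q).coeff i‖ := by
      refine (norm_nonneg _).lt_of_ne fun h0 => ?_
      simp only [← h0, zero_mul] at hi1
      exact zero_ne_one hi1
    exact le_of_pow_le_pow_left₀ (Nat.one_le_iff_ne_zero.1 (Finset.mem_Icc.1 hi).1)
      (norm_nonneg _) (le_of_mul_le_mul_left h hpos)
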